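/- All distributive lattices have a least element $0$ and a greatest element $1$, preserved by homomorphisms; $DL(m)$ is the free distributive lattice on the set $\{1,\dots,m\}$. A map $\alpha : n \to DL(m)$ is an $n$-tuple of lattice polynomials in $m$ variables. For a distributive lattice $L$ and $d \in L^m$ write $\alpha(d) \in L^n$ for its value, and for $\gamma : m \to DL(k)$ write $\alpha\gamma : n \to DL(k)$ for the tuple obtained by substituting $\gamma$ into $\alpha$. These are the morphisms $n \to m$ of, and the composition in, the Kleisli category of the free-distributive-lattice monad on finite sets (with objects the natural numbers $n$, standing for $n$-element sets). Let $\Box$ be the opposite of this Kleisli category, so that $\Box(m,n)$ is the set of maps $n \to DL(m)$, and let $\widehat{\Box}=[\Box^{\mathrm{op}},\mathrm{Set}]$ be the topos of cubical sets. Let $\mathbb{I}$ be the distributive lattice in $\widehat{\Box}$ with $\mathbb{I}(n) = DL(n)$. "Topos" means Grothendieck topos. A distributive lattice $D$ in a category with finite products is an object with morphisms $\wedge,\vee : D\times D\to D$ and $0,1 : \mathbf 1\to D$ satisfying the usual axioms. For each object $U$ the set $\mathrm{Hom}(U,D)$ is then a distributive lattice. Call $D$ *flat* if it satisfies the following freeness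 condition in the internal language: for all $n,m$ and $\alpha,\beta : n\to DL(m)$, every object $U$ and every $d\in \mathrm{Hom}(U,D)^m$ with $\alpha(d)=\beta(d)$, the family of all morphisms $p : V\to U$ for which there are $k$, $\gamma : m\to DL(k)$ and $d'\in \mathrm{Hom}(V,D)^k$ with $\alpha\gamma=\beta\gamma$ and $\gamma(d')=d\circ p$ is jointly epimorphic. For toposes $\mathcal X,\mathcal Y$ let $\mathrm{Geom}(\mathcal X,\mathcal Y)$ be the category of geometric morphisms $f : \mathcal{X}\to\mathcal{Y}$ (adjunctions $f^*\dashv f_*$ with $f^*$ left exact), with natural transformations $f^*\Rightarrow g^*$ as morphisms, and let $\mathrm{FlatDL}(\mathcal X)$ be the category of flat distributive lattices in $\mathcal X$ and lattice homomorphisms. **Theorem.** The topos $\widehat{\Box}$ of cubical sets classifies flat distributive lattices, with generic model $\mathbb{I}$. That is, $\widehat\Box$ is a topos, $\mathbb{I}$ is a flat distributive lattice in $\widehat{\Box}$, and for every topos $\mathcal X$ the assignment $f\mapsto f^*\mathbb{I}$ is a well-defined equivalence of categories $$\mathrm{Geom}(\mathcal X,\widehat{\Box})\;\simeq\;\mathrm{FlatDL}(\mathcal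 X).$$ This equivalence is natural in $\mathcal X$: for every geometric morphism $g:\mathcal Y\to\mathcal X$ of toposes, $g^*$ preserves flat distributive lattices, and the functors $f\mapsto (f\circ g)^*\mathbb{I}$ and $f\mapsto g^*(f^*\mathbb{I})$ from $\mathrm{Geom}(\mathcal X,\widehat{\Box})$ to distributive lattices in $\mathcal Y$ are naturally isomorphic. -/

import Mathlib

open CategoryTheory CategoryTheory.Limits Opposite

universe v u w w'

/-- A distributive lattice from operations satisfying the equational axioms. -/
abbrev mkDistribLattice {L : Type w} (inf sup : L → L → L)
    (inf_comm : ∀ a b, inf a b = inf b a) (sup_comm : ∀ a b, sup a b = sup b a)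
    (inf_assoc : ∀ a b c, inf (inf a b) c = inf a (inf b c))
    (sup_assoc : ∀ a b c, sup (sup a b) c = sup a (sup b c))
    (sup_inf_self : ∀ a b, sup a (inf a b) = a) (inf_sup_self : ∀ a b, inf a (sup a b) = a)
    (inf_sup_left : ∀ a b c, inf a (sup b c) = sup (inf a b) (inf a c)) : DistribLattice L :=
  have inf_idem : ∀ a, inf a a = a := fun a => by
    have h := inf_sup_self a (inf a a)
    rwa [sup_inf_self] at h
  have le_iff : ∀ a b, inf a b = a ↔ sup a b = b := fun a b =>
    ⟨fun h => by rw [← h, sup_comm, inf_comm, sup_inf_self],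
      fun h => by rw [← h, inf_sup_self]⟩
  let lat : Lattice L :=
    { sup := sup
      inf := inf
      le := fun a b => inf a b = a
      le_refl := inf_idem
      le_trans := fun a b c hab hbc => by rw [← hab, inf_assoc, hbc]
      le_antisymm := fun a b hab hba => by rw [← hab, inf_comm, hba]
      le_sup_left := fun a b => inf_sup_self a b
      le_sup_right := fun a b => by rw [sup_comm, inf_sup_self]
      sup_le := fun a b c hac hbc => by
        rw [le_iff] at hac hbc ⊢
        rw [sup_assoc, hbc, hac]
      inf_le_left := fun a b => by rw [inf_comm, ← inf_assoc, inf_idem]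
      inf_le_right := fun a b => by rw [inf_assoc, inf_idem]
      le_inf := fun a b c hab hac => by rw [← inf_assoc, hab, hac] }
  { lat with
    le_sup_inf := (DistribLattice.ofInfSupLe (fun a b c =>
      le_of_eq (inf_sup_left a b c))).le_sup_inf }

/-! ### Free distributive lattices (with top and bottom) -/

/-- Formal expressions in the language `(⊥, ⊤, ⊓, ⊔)` with variables in `X`. -/
inductive DLTerm (X : Type v) : Type v
  | var : X → DLTerm X
  | bot : DLTerm X
  | top : DLTerm X
  | inf : DLTerm X → DLTerm X → DLTerm X
  | sup : DLTerm X → DLTerm X → DLTerm X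

/-- The congruence on expressions generated by the axioms of bounded distributive lattices. -/
inductive DLTerm.Rel {X : Type v} : DLTerm X → DLTerm X → Prop
  | refl (a) : Rel a a
  | symm {a b} : Rel a b → Rel b a
  | trans {a b c} : Rel a b → Rel b c → Rel a c
  | inf_congr {a a' b b'} : Rel a a' → Rel b b' → Rel (inf a b) (inf a' b')
  | sup_congr {a a' b b'} : Rel a a' → Rel b b' → Rel (sup a b) (sup a' b')
  | inf_comm (a b) : Rel (inf a b) (inf b a)
  | sup_comm (a b) : Rel (sup a b) (sup b a)
  | inf_assoc (a b c) : Rel (inf (inf a b) c) (inf a (inf b c))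
  | sup_assoc (a b c) : Rel (sup (sup a b) c) (sup a (sup b c))
  | sup_inf_self (a b) : Rel (sup a (inf a b)) a
  | inf_sup_self (a b) : Rel (inf a (sup a b)) a
  | inf_sup_left (a b c) : Rel (inf a (sup b c)) (sup (inf a b) (inf a c))
  | sup_bot (a) : Rel (sup a bot) a
  | inf_top (a) : Rel (inf a top) a

instance DLTerm.setoid (X : Type v) : Setoid (DLTerm X) where
  r := DLTerm.Rel
  iseqv := ⟨DLTerm.Rel.refl, DLTerm.Rel.symm, DLTerm.Rel.trans⟩

/-- The free (bounded) distributive lattice on `X`. -/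
def FreeDL (X : Type v) : Type v := Quotient (DLTerm.setoid X)

namespace FreeDL

variable {X : Type v}

/-- The generators. -/
def of (x : X) : FreeDL X := Quotient.mk _ (DLTerm.var x)

instance : DistribLattice (FreeDL X) :=
  mkDistribLattice
    (Quotient.map₂ DLTerm.inf fun _ _ h _ _ h' => DLTerm.Rel.inf_congr h h')
    (Quotient.map₂ DLTerm.sup fun _ _ h _ _ h' => DLTerm.Rel.sup_congr h h')
    (by rintro ⟨a⟩ ⟨b⟩; exact Quotient.sound (DLTerm.Rel.inf_comm a b))
    (by rintro ⟨a⟩ ⟨b⟩; exact Quotient.sound (DLTerm.Rel.sup_comm a b))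
    (by rintro ⟨a⟩ ⟨b⟩ ⟨c⟩; exact Quotient.sound (DLTerm.Rel.inf_assoc a b c))
    (by rintro ⟨a⟩ ⟨b⟩ ⟨c⟩; exact Quotient.sound (DLTerm.Rel.sup_assoc a b c))
    (by rintro ⟨a⟩ ⟨b⟩; exact Quotient.sound (DLTerm.Rel.sup_inf_self a b))
    (by rintro ⟨a⟩ ⟨b⟩; exact Quotient.sound (DLTerm.Rel.inf_sup_self a b))
    (by rintro ⟨a⟩ ⟨b⟩ ⟨c⟩; exact Quotient.sound (DLTerm.Rel.inf_sup_left a b c))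

instance : BoundedOrder (FreeDL X) where
  top := Quotient.mk _ DLTerm.top
  bot := Quotient.mk _ DLTerm.bot
  le_top := by
    rintro ⟨a⟩; exact inf_eq_left.1 (Quotient.sound (DLTerm.Rel.inf_top a))
  bot_le := by
    rintro ⟨a⟩; exact sup_eq_left.1 (Quotient.sound (DLTerm.Rel.sup_bot a))

end FreeDL

/-- Evaluation of an expression in a distributive lattice. -/
def DLTerm.eval {X : Type v} {L : Type w} [DistribLattice L] [BoundedOrder L] (f : X → L) :
    DLTerm X → L
  | var x => f x
  | bot => ⊥
  | top => ⊤
  | inf a b => a.eval f ⊓ b.eval f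
  | sup a b => a.eval f ⊔ b.eval f

theorem DLTerm.Rel.eval_eq {X : Type v} {L : Type w} [DistribLattice L] [BoundedOrder L]
    (f : X → L) {a b : DLTerm X} (h : DLTerm.Rel a b) : a.eval f = b.eval f := by
  induction h with
  | refl a => rfl
  | symm _ ih => exact ih.symm
  | trans _ _ ih ih' => exact ih.trans ih'
  | inf_congr _ _ ih ih' => simp only [DLTerm.eval, ih, ih']
  | sup_congr _ _ ih ih' => simp only [DLTerm.eval, ih, ih']
  | inf_comm a b => exact _root_.inf_comm _ _
  | sup_comm a b => exact _root_.sup_comm _ _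
  | inf_assoc a b c => exact _root_.inf_assoc _ _ _
  | sup_assoc a b c => exact _root_.sup_assoc _ _ _
  | sup_inf_self a b => exact _root_.sup_inf_self
  | inf_sup_self a b => exact _root_.inf_sup_self
  | inf_sup_left a b c => exact _root_.inf_sup_left _ _ _
  | sup_bot a => exact sup_bot_eq _
  | inf_top a => exact inf_top_eq _

/-- The homomorphism `FreeDL X → L` extending `f : X → L`. For `f = d : Fin m → L` and
`t : FreeDL (Fin m)` this is the value `t(d)` of the polynomial `t` at `d`; for
`f : X → FreeDL Y` it is the Kleisli extension (substitution). -/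
def FreeDL.lift {X : Type v} {L : Type w} [DistribLattice L] [BoundedOrder L] (f : X → L)
    (t : FreeDL X) : L :=
  Quotient.lift (DLTerm.eval f) (fun _ _ h => DLTerm.Rel.eval_eq f h) t

namespace FreeDL

variable {X : Type v} {L : Type w} [DistribLattice L] [BoundedOrder L] (f : X → L)

theorem lift_inf (a b : FreeDL X) : lift f (a ⊓ b) = lift f a ⊓ lift f b := by
  obtain ⟨a⟩ := a; obtain ⟨b⟩ := b; rfl

theorem lift_sup (a b : FreeDL X) : lift f (a ⊔ b) = lift f a ⊔ lift f b := by
  obtain ⟨a⟩ := a; obtain ⟨b⟩ := b; rfl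

end FreeDL

theorem FreeDL.lift_of_eq {X : Type v} (t : FreeDL X) : FreeDL.lift FreeDL.of t = t := by
  obtain ⟨t⟩ := t
  change DLTerm.eval FreeDL.of t = Quotient.mk _ t
  induction t with
  | var x => rfl
  | bot => rfl
  | top => rfl
  | inf a b iha ihb => simp only [DLTerm.eval, iha, ihb]; rfl
  | sup a b iha ihb => simp only [DLTerm.eval, iha, ihb]; rfl

theorem FreeDL.lift_lift {X : Type v} {Y : Type w} {L : Type w'} [DistribLattice L]
    [BoundedOrder L] (f : X → FreeDL Y) (g : Y → L) (t : FreeDL X) :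
    FreeDL.lift g (FreeDL.lift f t) = FreeDL.lift (fun x => FreeDL.lift g (f x)) t := by
  obtain ⟨t⟩ := t
  change FreeDL.lift g (DLTerm.eval f t) = DLTerm.eval (fun x => FreeDL.lift g (f x)) t
  induction t with
  | var x => rfl
  | bot => rfl
  | top => rfl
  | inf a b iha ihb => simp only [DLTerm.eval, FreeDL.lift_inf, iha, ihb]
  | sup a b iha ihb => simp only [DLTerm.eval, FreeDL.lift_sup, iha, ihb]

/-! ### The cube category and cubical sets -/

/-- The cube category. The object of dimension `n` stands for the finite set `Fin n`. A morphism
`I ⟶ J` is a map `J → DL(I)`, that is, a Kleisli map from `J` to `I` for the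
free-distributive-lattice monad: this is the opposite of the Kleisli category on finite sets, or
the Lawvere theory of distributive lattices, so that presheaves on it are the covariant
functors on the Kleisli category. -/
structure Cube : Type where
  dim : ℕ

instance : SmallCategory Cube where
  Hom I J := Fin J.dim → FreeDL (Fin I.dim)
  id _ := FreeDL.of
  comp {_ _ _} f g := fun k => FreeDL.lift f (g k)
  id_comp f := funext fun k => FreeDL.lift_of_eq (f k)
  comp_id _ := rfl
  assoc f g h := funext fun k => (FreeDL.lift_lift g f (h k)).symm

/-- The topos of cubical sets. -/
abbrev CubicalSet := Cubeᵒᵖ ⥤ Type u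

/-! ### Distributive lattices in a category with finite products -/

section Internal

variable {C : Type w} [Category.{v} C] [HasFiniteProducts C]

/-- A binary operation, applied to generalized elements. -/
noncomputable abbrev opApp {A U : C} (m : A ⨯ A ⟶ A) (a b : U ⟶ A) : U ⟶ A :=
  prod.lift a b ≫ m

/-- A constant, as a generalized element. -/
noncomputable abbrev constApp {A : C} (c : ⊤_ C ⟶ A) (U : C) : U ⟶ A :=
  terminal.from U ≫ c

variable (C) in
/-- An internal (bounded) distributive lattice. The axioms are stated for generalized elements,
which by the Yoneda lemma is the commutativity of the usual diagrams. -/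
structure InternalDL where
  obj : C
  inf : obj ⨯ obj ⟶ obj
  sup : obj ⨯ obj ⟶ obj
  bot : ⊤_ C ⟶ obj
  top : ⊤_ C ⟶ obj
  inf_comm : ∀ {U : C} (a b : U ⟶ obj), opApp inf a b = opApp inf b a
  sup_comm : ∀ {U : C} (a b : U ⟶ obj), opApp sup a b = opApp sup b a
  inf_assoc : ∀ {U : C} (a b c : U ⟶ obj),
    opApp inf (opApp inf a b) c = opApp inf a (opApp inf b c)
  sup_assoc : ∀ {U : C} (a b c : U ⟶ obj),
    opApp sup (opApp sup a b) c = opApp sup a (opApp sup b c)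
  sup_inf_self : ∀ {U : C} (a b : U ⟶ obj), opApp sup a (opApp inf a b) = a
  inf_sup_self : ∀ {U : C} (a b : U ⟶ obj), opApp inf a (opApp sup a b) = a
  inf_sup_left : ∀ {U : C} (a b c : U ⟶ obj),
    opApp inf a (opApp sup b c) = opApp sup (opApp inf a b) (opApp inf a c)
  sup_bot : ∀ {U : C} (a : U ⟶ obj), opApp sup a (constApp bot U) = a
  inf_top : ∀ {U : C} (a : U ⟶ obj), opApp inf a (constApp top U) = a

namespace InternalDL

/-- Homomorphisms of internal distributive lattices. -/
@[ext]
structure Hom (D E : InternalDL C) where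
  hom : D.obj ⟶ E.obj
  map_inf : D.inf ≫ hom = prod.map hom hom ≫ E.inf
  map_sup : D.sup ≫ hom = prod.map hom hom ≫ E.sup
  map_bot : D.bot ≫ hom = E.bot
  map_top : D.top ≫ hom = E.top

instance : Category (InternalDL C) where
  Hom := Hom
  id D := ⟨𝟙 _, by simp, by simp, by simp, by simp⟩
  comp f g := ⟨f.hom ≫ g.hom,
    by rw [← Category.assoc, f.map_inf, Category.assoc, g.map_inf, prod.map_map_assoc],
    by rw [← Category.assoc, f.map_sup, Category.assoc, g.map_sup, prod.map_map_assoc],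
    by rw [← Category.assoc, f.map_bot, g.map_bot],
    by rw [← Category.assoc, f.map_top, g.map_top]⟩
  id_comp _ := Hom.ext (Category.id_comp _)
  comp_id _ := Hom.ext (Category.comp_id _)
  assoc _ _ _ := Hom.ext (Category.assoc _ _ _)

variable (D : InternalDL C)

/-- The generalized elements of `D` at stage `U`; they form a distributive lattice. -/
def Elt (U : C) : Type v := U ⟶ D.obj

noncomputable instance (U : C) : DistribLattice (D.Elt U) :=
  mkDistribLattice (L := U ⟶ D.obj) (opApp D.inf) (opApp D.sup) D.inf_comm D.sup_comm
    D.inf_assoc D.sup_assoc D.sup_inf_self D.inf_sup_self D.inf_sup_left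

noncomputable instance (U : C) : BoundedOrder (D.Elt U) where
  top := constApp D.top U
  bot := constApp D.bot U
  le_top a := inf_eq_left.1 (D.inf_top a)
  bot_le a := sup_eq_left.1 (D.sup_bot a)

/-- Restriction of a generalized element along `p : V ⟶ U`. -/
def Elt.restrict {D : InternalDL C} {U V : C} (p : V ⟶ U) (a : D.Elt U) : D.Elt V :=
  show V ⟶ D.obj from p ≫ a

/-- `D` is flat: it satisfies the freeness condition, read in the internal language.
If `α, β : n → DL(m)` take the same value at a generalized element `d` of `D ^ m` at stage `U`,
then `U` is covered by (that is, there is a jointly epimorphic family of) maps `p : V ⟶ U` such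
that for some `γ : m → DL(k)` and some `d'` in `D ^ k` at stage `V`, `αγ = βγ` and
`γ(d') = d` at stage `V`. -/
def IsFlat : ObjectProperty (InternalDL C) := fun D =>
  ∀ (n m : ℕ) (α β : Fin n → FreeDL (Fin m)) (U : C) (d : Fin m → D.Elt U),
    (∀ i, FreeDL.lift d (α i) = FreeDL.lift d (β i)) →
    ∀ (W : C) (f g : U ⟶ W),
      (∀ (V : C) (p : V ⟶ U),
        (∃ (k : ℕ) (γ : Fin m → FreeDL (Fin k)) (d' : Fin k → D.Elt V),
          (∀ i, FreeDL.lift γ (α i) = FreeDL.lift γ (β i)) ∧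
          (∀ j, FreeDL.lift d' (γ j) = (d j).restrict p)) →
        p ≫ f = p ≫ g) →
      f = g

end InternalDL

/-! ### The image of an internal distributive lattice under a left exact functor -/

section Map

variable {C' : Type w'} [Category.{v} C'] [HasFiniteProducts C']
variable (F : C ⥤ C') [PreservesFiniteLimits F]

/-- The image of a binary operation under `F`. -/
noncomputable def mapOp {A : C} (m : A ⨯ A ⟶ A) : F.obj A ⨯ F.obj A ⟶ F.obj A :=
  inv (prodComparison F A A) ≫ F.map m

/-- The image of a constant under `F`. -/
noncomputable def mapConst {A : C} (c : ⊤_ C ⟶ A) : ⊤_ C' ⟶ F.obj A :=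
  inv (terminalComparison F) ≫ F.map c

theorem opApp_mapOp {A V : C} {U : C'} (m : A ⨯ A ⟶ A) (w : U ⟶ F.obj V) (x y : V ⟶ A) :
    opApp (mapOp F m) (w ≫ F.map x) (w ≫ F.map y) = w ≫ F.map (opApp m x y) := by
  have : prod.lift (w ≫ F.map x) (w ≫ F.map y) =
      w ≫ F.map (prod.lift x y) ≫ prodComparison F A A := by
    apply prod.hom_ext
    · rw [prod.lift_fst, Category.assoc, Category.assoc, prodComparison_fst, ← F.map_comp,
        prod.lift_fst]
    · rw [prod.lift_snd, Category.assoc, Category.assoc, prodComparison_snd, ← F.map_comp,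
        prod.lift_snd]
  simp [opApp, mapOp, this]

theorem constApp_mapConst {A V : C} {U : C'} (c : ⊤_ C ⟶ A) (w : U ⟶ F.obj V) :
    constApp (mapConst F c) U = w ≫ F.map (constApp c V) := by
  have : terminal.from U = w ≫ F.map (terminal.from V) ≫ terminalComparison F :=
    Subsingleton.elim _ _
  simp [constApp, mapConst, this]

theorem exists_three {A : C} {U : C'} (a b c : U ⟶ F.obj A) :
    ∃ (V : C) (w : U ⟶ F.obj V) (x y z : V ⟶ A),
      a = w ≫ F.map x ∧ b = w ≫ F.map y ∧ c = w ≫ F.map z := by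
  have h₁ : ∀ B : C, inv (prodComparison F A B) ≫ F.map prod.fst = prod.fst := fun B => by
    rw [IsIso.inv_comp_eq, prodComparison_fst]
  have h₂ : ∀ B : C, inv (prodComparison F A B) ≫ F.map prod.snd = prod.snd := fun B => by
    rw [IsIso.inv_comp_eq, prodComparison_snd]
  have h₂' : ∀ (B : C) {Z : C'} (h : F.obj B ⟶ Z),
      inv (prodComparison F A B) ≫ F.map prod.snd ≫ h = prod.snd ≫ h := fun B _ h => by
    rw [← Category.assoc, h₂]
  refine ⟨A ⨯ (A ⨯ A), prod.lift a (prod.lift b c ≫ inv (prodComparison F A A)) ≫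
    inv (prodComparison F A (A ⨯ A)), prod.fst, prod.snd ≫ prod.fst, prod.snd ≫ prod.snd,
    ?_, ?_, ?_⟩
  · rw [Category.assoc, h₁, prod.lift_fst]
  · rw [Category.assoc, F.map_comp, h₂', prod.lift_snd_assoc, Category.assoc, h₁, prod.lift_fst]
  · rw [Category.assoc, F.map_comp, h₂', prod.lift_snd_assoc, Category.assoc, h₂, prod.lift_snd]

/-- The internal distributive lattice `F D`, for `F` left exact. -/
noncomputable def InternalDL.map (D : InternalDL C) : InternalDL C' where
  obj := F.obj D.obj
  inf := mapOp F D.inf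
  sup := mapOp F D.sup
  bot := mapConst F D.bot
  top := mapConst F D.top
  inf_comm a b := by
    obtain ⟨V, w, x, y, z, rfl, rfl, -⟩ := exists_three F a b b
    rw [opApp_mapOp, opApp_mapOp, D.inf_comm]
  sup_comm a b := by
    obtain ⟨V, w, x, y, z, rfl, rfl, -⟩ := exists_three F a b b
    rw [opApp_mapOp, opApp_mapOp, D.sup_comm]
  inf_assoc a b c := by
    obtain ⟨V, w, x, y, z, rfl, rfl, rfl⟩ := exists_three F a b c
    simp only [opApp_mapOp, D.inf_assoc]
  sup_assoc a b c := by
    obtain ⟨V, w, x, y, z, rfl, rfl, rfl⟩ := exists_three F a b c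
    simp only [opApp_mapOp, D.sup_assoc]
  sup_inf_self a b := by
    obtain ⟨V, w, x, y, z, rfl, rfl, -⟩ := exists_three F a b b
    simp only [opApp_mapOp, D.sup_inf_self]
  inf_sup_self a b := by
    obtain ⟨V, w, x, y, z, rfl, rfl, -⟩ := exists_three F a b b
    simp only [opApp_mapOp, D.inf_sup_self]
  inf_sup_left a b c := by
    obtain ⟨V, w, x, y, z, rfl, rfl, rfl⟩ := exists_three F a b c
    simp only [opApp_mapOp, D.inf_sup_left]
  sup_bot a := by
    obtain ⟨V, w, x, y, z, rfl, -, -⟩ := exists_three F a a a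
    rw [constApp_mapConst F D.bot w, opApp_mapOp, D.sup_bot]
  inf_top a := by
    obtain ⟨V, w, x, y, z, rfl, -, -⟩ := exists_three F a a a
    rw [constApp_mapConst F D.top w, opApp_mapOp, D.inf_top]

theorem mapOp_natural {A B : C} {m : A ⨯ A ⟶ A} {m' : B ⨯ B ⟶ B} {h : A ⟶ B}
    (hm : m ≫ h = prod.map h h ≫ m') :
    mapOp F m ≫ F.map h = prod.map (F.map h) (F.map h) ≫ mapOp F m' := by
  rw [mapOp, mapOp, Category.assoc, IsIso.inv_comp_eq, ← F.map_comp, hm, F.map_comp,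
    ← Category.assoc, ← Category.assoc, ← prodComparison_natural, Category.assoc, Category.assoc,
    IsIso.hom_inv_id_assoc]

/-- A left exact functor acts on internal distributive lattices. -/
noncomputable def mapInternalDL : InternalDL C ⥤ InternalDL C' where
  obj D := D.map F
  map f :=
    { hom := F.map f.hom
      map_inf := mapOp_natural F f.map_inf
      map_sup := mapOp_natural F f.map_sup
      map_bot := by
        change mapConst F _ ≫ _ = mapConst F _
        rw [mapConst, mapConst, Category.assoc, ← F.map_comp, f.map_bot]
      map_top := by
        change mapConst F _ ≫ _ = mapConst F _
        rw [mapConst, mapConst, Category.assoc, ← F.map_comp, f.map_top] }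
  map_id _ := InternalDL.Hom.ext (F.map_id _)
  map_comp _ _ := InternalDL.Hom.ext (F.map_comp _ _)

theorem mapOp_app {F G : C ⥤ C'} [PreservesFiniteLimits F] [PreservesFiniteLimits G] (τ : F ⟶ G)
    {A : C} (m : A ⨯ A ⟶ A) :
    mapOp F m ≫ τ.app A = prod.map (τ.app A) (τ.app A) ≫ mapOp G m := by
  have h : τ.app (A ⨯ A) ≫ prodComparison G A A =
      prodComparison F A A ≫ prod.map (τ.app A) (τ.app A) := by
    ext <;> simp [prodComparison]
  rw [mapOp, mapOp, Category.assoc, IsIso.inv_comp_eq, τ.naturality, ← Category.assoc,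
    ← Category.assoc, ← h, Category.assoc, Category.assoc, IsIso.hom_inv_id_assoc]

theorem mapConst_app {F G : C ⥤ C'} [PreservesFiniteLimits F] [PreservesFiniteLimits G]
    (τ : F ⟶ G) {A : C} (c : ⊤_ C ⟶ A) : mapConst F c ≫ τ.app A = mapConst G c := by
  have h : τ.app (⊤_ C) ≫ terminalComparison G = terminalComparison F := Subsingleton.elim _ _
  rw [mapConst, mapConst, Category.assoc, IsIso.inv_comp_eq, τ.naturality, ← h, Category.assoc,
    IsIso.hom_inv_id_assoc]

end Map

end Internal

/-! ### Toposes and geometric morphisms -/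

/-- A (Grothendieck) topos: a category equivalent to the category of sheaves of sets on a small
site. -/
class IsGrothendieckTopos (X : Type w) [Category.{u} X] : Prop where
  exists_site : ∃ (C : Type u) (_ : SmallCategory C) (J : GrothendieckTopology C),
    Nonempty (X ≌ Sheaf J (Type u))

instance (X : Type w) [Category.{u} X] [h : IsGrothendieckTopos X] : HasFiniteLimits X := by
  obtain ⟨C, _, J, ⟨e⟩⟩ := h.exists_site
  exact ⟨fun _ _ _ => Adjunction.hasLimitsOfShape_of_equivalence e.functor⟩

/-- A geometric morphism `X ⟶ Y`: an adjunction `inverse ⊣ direct` with `inverse` left exact. -/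
structure GeomMor (X : Type w) [Category.{u} X] (Y : Type w') [Category.{u} Y] where
  inverse : Y ⥤ X
  direct : X ⥤ Y
  adj : inverse ⊣ direct
  lex : PreservesFiniteLimits inverse

namespace GeomMor

attribute [instance] GeomMor.lex

variable {X : Type w} [Category.{u} X] {Y : Type w'} [Category.{u} Y] {Z : Type v} [Category.{u} Z]

/-- The category of geometric morphisms: a morphism is a natural transformation of the inverse
image functors. -/
instance : Category (GeomMor X Y) where
  Hom f g := f.inverse ⟶ g.inverse
  id f := NatTrans.id f.inverse
  comp σ τ := NatTrans.vcomp σ τ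

/-- The composite `X ⟶ Y ⟶ Z`. -/
def comp (g : GeomMor X Y) (f : GeomMor Y Z) : GeomMor X Z where
  inverse := f.inverse ⋙ g.inverse
  direct := g.direct ⋙ f.direct
  adj := f.adj.comp g.adj
  lex := comp_preservesFiniteLimits _ _

/-- Composition with `g : X ⟶ Y`, as a functor from geometric morphisms `Y ⟶ Z` to geometric
morphisms `X ⟶ Z`. -/
def precomp (g : GeomMor X Y) : GeomMor Y Z ⥤ GeomMor X Z where
  obj f := g.comp f
  map {f f'} τ := show f.inverse ⋙ g.inverse ⟶ f'.inverse ⋙ g.inverse from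
    Functor.whiskerRight (show f.inverse ⟶ f'.inverse from τ) g.inverse
  map_id f := Functor.whiskerRight_id g.inverse
  map_comp σ τ := Functor.whiskerRight_comp σ τ g.inverse

/-- The functor `f ↦ f^* D`, for an internal distributive lattice `D` of `Y`. -/
noncomputable def pullbackDL [HasFiniteProducts X] [HasFiniteProducts Y] (D : InternalDL Y) :
    GeomMor X Y ⥤ InternalDL X where
  obj f := (mapInternalDL f.inverse).obj D
  map {f f'} τ :=
    { hom := NatTrans.app (show f.inverse ⟶ f'.inverse from τ) D.obj
      map_inf := mapOp_app (show f.inverse ⟶ f'.inverse from τ) D.inf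
      map_sup := mapOp_app (show f.inverse ⟶ f'.inverse from τ) D.sup
      map_bot := mapConst_app (show f.inverse ⟶ f'.inverse from τ) D.bot
      map_top := mapConst_app (show f.inverse ⟶ f'.inverse from τ) D.top }
  map_id _ := rfl
  map_comp _ _ := rfl

end GeomMor

/-! ### The generic flat distributive lattice -/

namespace CubicalSet

/-- The cubical set `𝕀` with `𝕀(n) = DL(n)`. -/
def interval : CubicalSet.{u} where
  obj I := ULift.{u} (FreeDL (Fin I.unop.dim))
  map f := TypeCat.ofHom fun t => ULift.up (FreeDL.lift f.unop t.down)
  map_id I := ConcreteCategory.hom_ext (C := Type u) _ _ fun t => congrArg ULift.up (FreeDL.lift_of_eq t.down)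
  map_comp f g := ConcreteCategory.hom_ext (C := Type u) _ _ fun t =>
    congrArg ULift.up (FreeDL.lift_lift f.unop g.unop t.down).symm

/-- An element of `𝕀(n)` as an element of `DL(n)`. -/
def val {I : Cubeᵒᵖ} (t : interval.{u}.obj I) : FreeDL (Fin I.unop.dim) := ULift.down t

/-- A natural family of binary operations on the lattices `DL(n)`, as an operation on `𝕀`. -/
noncomputable def intervalOp (m : ∀ n : ℕ, FreeDL (Fin n) → FreeDL (Fin n) → FreeDL (Fin n))
    (hm : ∀ (k n : ℕ) (f : Fin k → FreeDL (Fin n)) (a b : FreeDL (Fin k)),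
      FreeDL.lift f (m k a b) = m n (FreeDL.lift f a) (FreeDL.lift f b)) :
    interval.{u} ⨯ interval ⟶ interval where
  app I := TypeCat.ofHom fun x => ULift.up (m I.unop.dim
    (val ((prod.fst : interval.{u} ⨯ interval ⟶ interval).app I x))
    (val ((prod.snd : interval.{u} ⨯ interval ⟶ interval).app I x)))
  naturality I J f := ConcreteCategory.hom_ext (C := Type u) _ _ fun x => by
    have h₁ := NatTrans.naturality_apply (prod.fst : interval.{u} ⨯ interval ⟶ interval) f x
    have h₂ := NatTrans.naturality_apply (prod.snd : interval.{u} ⨯ interval ⟶ interval) f x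
    apply congrArg ULift.up
    refine Eq.trans ?_ (hm _ _ f.unop _ _).symm
    exact congrArg₂ (m J.unop.dim) (congrArg val h₁) (congrArg val h₂)

/-- A natural family of constants of the lattices `DL(n)`, as a constant of `𝕀`. -/
noncomputable def intervalConst (c : ∀ n : ℕ, FreeDL (Fin n))
    (hc : ∀ (k n : ℕ) (f : Fin k → FreeDL (Fin n)), FreeDL.lift f (c k) = c n) :
    ⊤_ CubicalSet.{u} ⟶ interval where
  app I := TypeCat.ofHom fun _ => ULift.up (c I.unop.dim)
  naturality I J f := ConcreteCategory.hom_ext (C := Type u) _ _ fun _ => congrArg ULift.up (hc _ _ f.unop).symm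

theorem opApp_intervalOp (m : ∀ n : ℕ, FreeDL (Fin n) → FreeDL (Fin n) → FreeDL (Fin n)) (hm)
    {U : CubicalSet.{u}} (a b : U ⟶ interval) (I : Cubeᵒᵖ) (x : U.obj I) :
    val ((opApp (intervalOp m hm) a b).app I x) =
      m I.unop.dim (val (a.app I x)) (val (b.app I x)) := by
  have h₁ : (prod.fst : interval.{u} ⨯ interval ⟶ interval).app I ((prod.lift a b).app I x) =
      a.app I x := by
    rw [← NatTrans.comp_app_apply, prod.lift_fst]
  have h₂ : (prod.snd : interval.{u} ⨯ interval ⟶ interval).app I ((prod.lift a b).app I x) =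
      b.app I x := by
    rw [← NatTrans.comp_app_apply, prod.lift_snd]
  exact congrArg₂ (m I.unop.dim) (congrArg val h₁) (congrArg val h₂)

theorem hom_interval_ext {U : CubicalSet.{u}} {a b : U ⟶ interval}
    (h : ∀ (I : Cubeᵒᵖ) (x : U.obj I), val (a.app I x) = val (b.app I x)) : a = b := by
  refine NatTrans.ext (funext fun I => ConcreteCategory.hom_ext (C := Type u) _ _ fun x => ?_)
  exact ULift.down_injective (h I x)

/-- The generic distributive lattice `𝕀` in the topos of cubical sets, with the pointwise lattice
operations of `𝕀(n) = DL(n)`. -/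
noncomputable def intervalDL : InternalDL CubicalSet.{u} where
  obj := interval
  inf := intervalOp (fun _ a b => a ⊓ b) fun _ _ f a b => FreeDL.lift_inf f a b
  sup := intervalOp (fun _ a b => a ⊔ b) fun _ _ f a b => FreeDL.lift_sup f a b
  bot := intervalConst (fun _ => ⊥) fun _ _ _ => rfl
  top := intervalConst (fun _ => ⊤) fun _ _ _ => rfl
  inf_comm a b := hom_interval_ext fun I x => by
    simp only [opApp_intervalOp, inf_comm]
  sup_comm a b := hom_interval_ext fun I x => by
    simp only [opApp_intervalOp, sup_comm]
  inf_assoc a b c := hom_interval_ext fun I x => by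
    simp only [opApp_intervalOp, inf_assoc]
  sup_assoc a b c := hom_interval_ext fun I x => by
    simp only [opApp_intervalOp, sup_assoc]
  sup_inf_self a b := hom_interval_ext fun I x => by
    simp only [opApp_intervalOp, sup_inf_self]
  inf_sup_self a b := hom_interval_ext fun I x => by
    simp only [opApp_intervalOp, inf_sup_self]
  inf_sup_left a b c := hom_interval_ext fun I x => by
    simp only [opApp_intervalOp, inf_sup_left]
  sup_bot a := hom_interval_ext fun I x =>
    (opApp_intervalOp _ _ _ _ I x).trans (sup_bot_eq _)
  inf_top a := hom_interval_ext fun I x =>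
    (opApp_intervalOp _ _ _ _ I x).trans (inf_top_eq _)

end CubicalSet

/-!
Cubical sets are the presheaves on the cube category, which is the Lawvere theory of distributive
lattices. A distributive lattice `D` in a topos `X` therefore gives the functor `n ↦ D ^ n` from
the cube category to `X` (`InternalDL.powers`), and its left Kan extension along the Yoneda
embedding is a cocontinuous functor from cubical sets to `X`, the tensor product with `D`
(`InternalDL.tensor`). For `D = 𝕀` the functor `n ↦ D ^ n` is the Yoneda embedding itself
(`CubicalSet.yonedaIsoPowers`).

*Fully faithful.* An inverse image functor `f^*` is cocontinuous, so natural transformations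
`f^* ⟶ g^*` are natural transformations between the functors `f^*(𝕀 ^ n)` and `g^*(𝕀 ^ n)` of `n`.
As `f^*` and `g^*` are left exact these are powers, and such natural transformations are
homomorphisms `f^*𝕀 ⟶ g^*𝕀`, since homomorphisms are the morphisms that commute with all lattice
polynomials (`InternalDL.exists_powers_natTrans`).

*Essentially surjective.* For flat `D` the tensor product with `D` has to be left exact. The topos
is taken to be a category of sheaves on a small site. A section of the tensor product `R ⊗ D` is
locally given by a pair of a section of `D ^ n` and an `n`-cube of `R`. Flatness says that, up to
passing to a cover, the category of elements of `n ↦ D ^ n` is cofiltered; hence "having locally a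
common refinement" is an equivalence relation on such pairs
(`InternalDL.FormalSection.refineSieve_trans`). The sheaf of its equivalence classes receives a
morphism from `R ⊗ D`, so that pairs which are equal in `R ⊗ D` locally have common refinements
(`InternalDL.IsFlat.exists_local_refinement`). Left exactness follows as for filtered colimits of
sets: the terminal object is a representable, and the comparison morphism for a pullback is
injective and locally surjective on sections.

*Flatness of inverse images.* The condition of flatness has a universal instance on the equalizer
of two morphisms `D ^ m ⟶ D ^ n`. Left exact left adjoints preserve this instance, and jointly
epimorphic sieves in a topos are stable under pullback (`CategoryTheory.Sieve.JointlyEpi.pullback`),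
so flatness is preserved (`InternalDL.IsFlat.map`).
-/

/-! ### Jointly epimorphic sieves in a topos -/

namespace CategoryTheory

/-- A sieve is jointly epimorphic if two morphisms that agree after restriction along each of its
members are equal. -/
def Sieve.JointlyEpi {C : Type w} [Category.{v} C] {U : C} (S : Sieve U) : Prop :=
  ∀ ⦃W : C⦄ (f g : U ⟶ W), (∀ ⦃V : C⦄ (p : V ⟶ U), S p → p ≫ f = p ≫ g) → f = g

theorem Sieve.JointlyEpi.mono {C : Type w} [Category.{v} C] {U : C} {S T : Sieve U}
    (hS : S.JointlyEpi) (h : S ≤ T) : T.JointlyEpi :=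
  fun _ f g hfg => hS f g fun _ p hp => hfg p (h _ hp)

/-- A left adjoint preserves jointly epimorphic sieves. -/
theorem Sieve.JointlyEpi.functorPushforward {C : Type w} [Category.{v} C] {C' : Type w'}
    [Category.{v} C'] {F : C ⥤ C'} {G : C' ⥤ C} (adj : F ⊣ G) {U : C} {S : Sieve U}
    (hS : S.JointlyEpi) : (S.functorPushforward F).JointlyEpi := by
  intro W f g hfg
  apply (adj.homEquiv _ _).injective
  refine hS _ _ fun V p hp => ?_
  rw [← adj.homEquiv_naturality_left, ← adj.homEquiv_naturality_left,
    hfg _ (Sieve.image_mem_functorPushforward F S hp)]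

section Sheaf

variable {C : Type u} [SmallCategory C] {J : GrothendieckTopology C}

theorem Sheaf.comp_hom_app_apply {F G H : Sheaf J (Type u)} (f : F ⟶ G) (g : G ⟶ H) {s : Cᵒᵖ}
    (x : F.obj.obj s) : (f ≫ g).hom.app s x = g.hom.app s (f.hom.app s x) := rfl

theorem Sheaf.hom_app_map {F G : Sheaf J (Type u)} (f : F ⟶ G) {s t : Cᵒᵖ} (i : s ⟶ t)
    (x : F.obj.obj s) : f.hom.app t (F.obj.map i x) = G.obj.map i (f.hom.app s x) :=
  NatTrans.naturality_apply f.hom i x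

theorem Sheaf.map_comp_op_apply (F : Sheaf J (Type u)) {s t r : C} (g : r ⟶ t) (f : t ⟶ s)
    (x : F.obj.obj (op s)) :
    F.obj.map (g ≫ f).op x = F.obj.map g.op (F.obj.map f.op x) := by
  rw [op_comp, Functor.map_comp]; rfl

/-- Sections of a sheaf which agree locally are equal. -/
theorem Sheaf.section_ext (F : Sheaf J (Type u)) {s : C} {x y : F.obj.obj (op s)} {S : Sieve s}
    (hS : S ∈ J s) (h : ∀ ⦃t : C⦄ (f : t ⟶ s), S f → F.obj.map f.op x = F.obj.map f.op y) :
    x = y :=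
  (F.property.isSheafFor S hS).isSeparatedFor.ext fun _ f hf => h f hf

/-- Sections of a sheaf `U` over `s` lift, locally on `s`, along the members of a jointly
epimorphic sieve on `U`: the subsheaf of the sections with this property contains the images of all
members of the sieve, so that its inclusion is an epimorphism. -/
theorem Sieve.JointlyEpi.exists_local_section {U : Sheaf J (Type u)} {S : Sieve U}
    (hS : S.JointlyEpi) {s : C} (x : U.obj.obj (op s)) :
    ∃ T ∈ J s, ∀ ⦃t : C⦄ (f : t ⟶ s), T f →
      ∃ (V : Sheaf J (Type u)) (p : V ⟶ U) (y : V.obj.obj (op t)),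
        S p ∧ p.hom.app _ y = U.obj.map f.op x := by
  let G : Subfunctor U.obj :=
    { obj := fun t => {z | ∃ (V : Sheaf J (Type u)) (p : V ⟶ U) (y : V.obj.obj t),
        S p ∧ p.hom.app _ y = z}
      map := by
        rintro t r i z ⟨V, p, y, hp, rfl⟩
        exact ⟨V, p, V.obj.map i y, hp, Sheaf.hom_app_map p i y⟩ }
  let E : Sheaf J (Type u) := ⟨(G.sheafify J).toFunctor, by
    rw [isSheaf_iff_isSheaf_of_type]
    exact G.sheafify_isSheaf ((isSheaf_iff_isSheaf_of_type _ _).1 U.property)⟩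
  let ι : E ⟶ U := ⟨(G.sheafify J).ι⟩
  have : Mono ι := Sheaf.Hom.mono_of_presheaf_mono J (Type u) ι
  have : Epi ι := ⟨fun f g hfg => hS f g fun V p hp => by
    let q : V ⟶ E := ⟨
      { app := fun t => TypeCat.ofHom fun y =>
          ⟨p.hom.app t y, G.le_sheafify J _ ⟨V, p, y, hp, rfl⟩⟩
        naturality := fun t r i => ConcreteCategory.hom_ext (C := Type u) _ _ fun y =>
          Subtype.ext (Sheaf.hom_app_map p i y) }⟩
    have hq : p = q ≫ ι := rfl
    rw [hq, Category.assoc, Category.assoc, hfg]⟩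
  have : IsIso ι := isIso_of_mono_of_epi ι
  have hx : ι.hom.app _ ((inv ι).hom.app _ x) = x := by
    rw [← Sheaf.comp_hom_app_apply, IsIso.inv_hom_id]; rfl
  refine ⟨_, ((inv ι).hom.app _ x).2, fun t f hf => ?_⟩
  obtain ⟨V, p, y, hp, hy⟩ := hf
  refine ⟨V, p, y, hp, hy.trans ?_⟩
  exact congrArg (U.obj.map f.op) hx

/-- The sections of a pullback of sheaves. -/
theorem Sheaf.exists_section_of_isPullback {P A B D : Sheaf J (Type u)} {fst : P ⟶ A}
    {snd : P ⟶ B} {f : A ⟶ D} {g : B ⟶ D} (h : IsPullback fst snd f g) {s : C}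
    (a : A.obj.obj (op s)) (b : B.obj.obj (op s)) (hab : f.hom.app _ a = g.hom.app _ b) :
    ∃ x, fst.hom.app _ x = a ∧ snd.hom.app _ x = b := by
  have h' := h.map (sheafToPresheaf J (Type u) ⋙ (evaluation _ _).obj (op s))
  exact Types.exists_of_isPullback h' a b hab

theorem Sheaf.section_ext_of_isPullback {P A B D : Sheaf J (Type u)} {fst : P ⟶ A}
    {snd : P ⟶ B} {f : A ⟶ D} {g : B ⟶ D} (h : IsPullback fst snd f g) {s : C}
    {x y : P.obj.obj (op s)} (h₁ : fst.hom.app _ x = fst.hom.app _ y)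
    (h₂ : snd.hom.app _ x = snd.hom.app _ y) : x = y := by
  have h' := h.map (sheafToPresheaf J (Type u) ⋙ (evaluation _ _).obj (op s))
  exact Types.ext_of_isPullback h' h₁ h₂

theorem Sheaf.jointlyEpi_pullback {U U' : Sheaf J (Type u)} {S : Sieve U} (hS : S.JointlyEpi)
    (q : U' ⟶ U) : (S.pullback q).JointlyEpi := by
  intro W f g hfg
  ext s x
  obtain ⟨T, hT, h⟩ := hS.exists_local_section (q.hom.app s x)
  refine Sheaf.section_ext W hT fun t i hi => ?_
  obtain ⟨V, p, y, hp, hy⟩ := h i hi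
  have hP := IsPullback.of_hasPullback q p
  obtain ⟨z, hz, -⟩ := Sheaf.exists_section_of_isPullback hP (U'.obj.map i.op x) y
    (by rw [hy]; exact Sheaf.hom_app_map q _ _)
  have h1 := hfg (pullback.fst q p) (by
    change S _
    rw [pullback.condition]; exact S.downward_closed hp _)
  have h2 := congrArg (fun k => k.hom.app _ z) h1
  simp only [Sheaf.comp_hom_app_apply] at h2
  rw [hz, Sheaf.hom_app_map, Sheaf.hom_app_map] at h2
  exact h2

end Sheaf

/-- In a topos, jointly epimorphic sieves are stable under pullback. -/
theorem Sieve.JointlyEpi.pullback {X : Type w} [Category.{u} X] [h : IsGrothendieckTopos X]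
    {U U' : X} {S : Sieve U} (hS : S.JointlyEpi) (q : U' ⟶ U) : (S.pullback q).JointlyEpi := by
  obtain ⟨C, _, J, ⟨e⟩⟩ := h.exists_site
  intro W f g hfg
  apply e.functor.map_injective
  refine Sheaf.jointlyEpi_pullback (hS.functorPushforward e.toAdjunction)
    (e.functor.map q) _ _ fun V p hp => ?_
  obtain ⟨V₀, p₀, r, hp₀, hr⟩ := hp
  let p' : e.inverse.obj V ⟶ U' := e.inverse.map p ≫ e.unitInv.app U'
  have hp' : p = e.counitInv.app V ≫ e.functor.map p' := by
    simp [p']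
  rw [hp', Category.assoc, Category.assoc, ← e.functor.map_comp, ← e.functor.map_comp]
  congr 2
  apply hfg
  have : p' ≫ q = (e.inverse.map r ≫ e.unitInv.app V₀) ≫ p₀ := by
    have := congrArg (fun k => e.inverse.map k ≫ e.unitInv.app U) hr
    simp only [p', Functor.map_comp, Category.assoc] at this ⊢
    rw [e.inv_fun_map, e.inv_fun_map] at this
    simpa using this
  change S _
  rw [this]
  exact S.downward_closed hp₀ _

end CategoryTheory

/-! ### Values of lattice polynomials at generalized elements -/

theorem FreeDL.map_lift {X : Type v} {L : Type w} {L' : Type w'} [DistribLattice L]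
    [BoundedOrder L] [DistribLattice L'] [BoundedOrder L'] (φ : BoundedLatticeHom L L')
    (d : X → L) (t : FreeDL X) : φ (FreeDL.lift d t) = FreeDL.lift (fun x => φ (d x)) t := by
  obtain ⟨t⟩ := t
  change φ (DLTerm.eval d t) = DLTerm.eval (fun x => φ (d x)) t
  induction t with
  | var x => rfl
  | bot => exact map_bot φ
  | top => exact map_top φ
  | inf a b iha ihb => simp only [DLTerm.eval, map_inf, iha, ihb]
  | sup a b iha ihb => simp only [DLTerm.eval, map_sup, iha, ihb]

namespace InternalDL

section

variable {C : Type w} [Category.{v} C] [HasFiniteProducts C] {D E : InternalDL C}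

variable (D) in
/-- The value `t(d)` of a lattice polynomial `t` at a tuple `d` of generalized elements. -/
noncomputable def value {U : C} {n : ℕ} (d : Fin n → (U ⟶ D.obj)) (t : FreeDL (Fin n)) :
    U ⟶ D.obj :=
  FreeDL.lift (L := D.Elt U) d t

theorem value_of {U : C} {n : ℕ} (d : Fin n → (U ⟶ D.obj)) (i : Fin n) :
    D.value d (FreeDL.of i) = d i := rfl

theorem value_inf {U : C} {n : ℕ} (d : Fin n → (U ⟶ D.obj)) (s t : FreeDL (Fin n)) :
    D.value d (s ⊓ t) = opApp D.inf (D.value d s) (D.value d t) :=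
  FreeDL.lift_inf (L := D.Elt U) d s t

theorem value_sup {U : C} {n : ℕ} (d : Fin n → (U ⟶ D.obj)) (s t : FreeDL (Fin n)) :
    D.value d (s ⊔ t) = opApp D.sup (D.value d s) (D.value d t) :=
  FreeDL.lift_sup (L := D.Elt U) d s t

theorem value_bot {U : C} {n : ℕ} (d : Fin n → (U ⟶ D.obj)) :
    D.value d ⊥ = constApp D.bot U := rfl

theorem value_top {U : C} {n : ℕ} (d : Fin n → (U ⟶ D.obj)) :
    D.value d ⊤ = constApp D.top U := rfl

/-- Substitution. -/
theorem value_lift {U : C} {n m : ℕ} (d : Fin n → (U ⟶ D.obj)) (γ : Fin m → FreeDL (Fin n))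
    (t : FreeDL (Fin m)) :
    D.value d (FreeDL.lift γ t) = D.value (fun i => D.value d (γ i)) t :=
  FreeDL.lift_lift (L := D.Elt U) γ d t

theorem comp_opApp {A U V : C} (p : V ⟶ U) (m : A ⨯ A ⟶ A) (a b : U ⟶ A) :
    p ≫ opApp m a b = opApp m (p ≫ a) (p ≫ b) := by
  simp only [opApp, ← prod.comp_lift, Category.assoc]

theorem comp_constApp {A U V : C} (p : V ⟶ U) (c : ⊤_ C ⟶ A) :
    p ≫ constApp c U = constApp c V := by
  simp only [constApp, ← Category.assoc, terminal.comp_from]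

theorem comp_value {U V : C} {n : ℕ} (p : V ⟶ U) (d : Fin n → (U ⟶ D.obj))
    (t : FreeDL (Fin n)) : p ≫ D.value d t = D.value (fun i => p ≫ d i) t :=
  FreeDL.map_lift (L := D.Elt U) (L' := D.Elt V)
    { toFun := fun a => Elt.restrict p a
      map_inf' := comp_opApp p D.inf
      map_sup' := comp_opApp p D.sup
      map_bot' := comp_constApp p D.bot
      map_top' := comp_constApp p D.top } d t

theorem opApp_comp {A B U : C} {m : A ⨯ A ⟶ A} {m' : B ⨯ B ⟶ B} {h : A ⟶ B}
    (hm : m ≫ h = prod.map h h ≫ m') (a b : U ⟶ A) :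
    opApp m a b ≫ h = opApp m' (a ≫ h) (b ≫ h) := by
  simp only [opApp, Category.assoc, hm, prod.lift_map_assoc]

/-- Homomorphisms commute with lattice polynomials. -/
theorem value_comp_hom (h : D ⟶ E) {U : C} {n : ℕ} (d : Fin n → (U ⟶ D.obj))
    (t : FreeDL (Fin n)) : D.value d t ≫ Hom.hom h = E.value (fun i => d i ≫ Hom.hom h) t :=
  FreeDL.map_lift (L := D.Elt U) (L' := E.Elt U)
    { toFun := fun a => show U ⟶ E.obj from (show U ⟶ D.obj from a) ≫ Hom.hom h
      map_inf' := opApp_comp (Hom.map_inf h)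
      map_sup' := opApp_comp (Hom.map_sup h)
      map_bot' := (Category.assoc _ _ _).trans (congrArg _ (Hom.map_bot h))
      map_top' := (Category.assoc _ _ _).trans (congrArg _ (Hom.map_top h)) } d t

/-- A morphism that commutes with the lattice operations on generalized elements is a
homomorphism. -/
def homMk (h : D.obj ⟶ E.obj)
    (map_inf : ∀ {U : C} (a b : U ⟶ D.obj), opApp D.inf a b ≫ h = opApp E.inf (a ≫ h) (b ≫ h))
    (map_sup : ∀ {U : C} (a b : U ⟶ D.obj), opApp D.sup a b ≫ h = opApp E.sup (a ≫ h) (b ≫ h))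
    (map_bot : ∀ U : C, constApp D.bot U ≫ h = constApp E.bot U)
    (map_top : ∀ U : C, constApp D.top U ≫ h = constApp E.top U) : D ⟶ E :=
  show Hom D E from
  { hom := h
    map_inf := by
      have := map_inf (prod.fst : D.obj ⨯ D.obj ⟶ _) prod.snd
      rw [opApp, prod.lift_fst_snd, Category.id_comp] at this
      rw [this]
      rw [opApp, ← prod.map_fst h h, ← prod.map_snd h h, ← prod.comp_lift, prod.lift_fst_snd,
        Category.comp_id]
    map_sup := by
      have := map_sup (prod.fst : D.obj ⨯ D.obj ⟶ _) prod.snd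
      rw [opApp, prod.lift_fst_snd, Category.id_comp] at this
      rw [this]
      rw [opApp, ← prod.map_fst h h, ← prod.map_snd h h, ← prod.comp_lift, prod.lift_fst_snd,
        Category.comp_id]
    map_bot := by
      have := map_bot (⊤_ C)
      rwa [constApp, constApp, Subsingleton.elim (terminal.from (⊤_ C)) (𝟙 _), Category.id_comp,
        Category.id_comp] at this
    map_top := by
      have := map_top (⊤_ C)
      rwa [constApp, constApp, Subsingleton.elim (terminal.from (⊤_ C)) (𝟙 _), Category.id_comp,
        Category.id_comp] at this }

/-- A homomorphism whose underlying morphism is invertible is an isomorphism. -/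
theorem isIso_of_isIso_hom (h : D ⟶ E) [IsIso (Hom.hom h)] : IsIso h := by
  let k : E ⟶ D := show Hom E D from
    { hom := inv (Hom.hom h)
      map_inf := by
        rw [IsIso.comp_inv_eq, Category.assoc, Hom.map_inf, prod.map_map_assoc]
        simp
      map_sup := by
        rw [IsIso.comp_inv_eq, Category.assoc, Hom.map_sup, prod.map_map_assoc]
        simp
      map_bot := by rw [IsIso.comp_inv_eq, Hom.map_bot]
      map_top := by rw [IsIso.comp_inv_eq, Hom.map_top] }
  exact ⟨k, Hom.ext (IsIso.hom_inv_id (Hom.hom h)), Hom.ext (IsIso.inv_hom_id (Hom.hom h))⟩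

variable (D) in
/-- The functor `n ↦ D ^ n` on the cube category, which sends a tuple `α` of polynomials to the
morphism `d ↦ α(d)`. -/
noncomputable def powers : Cube ⥤ C where
  obj I := ∏ᶜ fun _ : Fin I.dim => D.obj
  map {I J} α := Pi.lift fun k => D.value (fun j => Pi.π (fun _ : Fin I.dim => D.obj) j) (α k)
  map_id I := by
    refine Pi.hom_ext _ _ fun k => ?_
    rw [Pi.lift_π, Category.id_comp]
    exact value_of _ k
  map_comp {I J K} α β := by
    refine Pi.hom_ext _ _ fun k => ?_
    rw [Pi.lift_π, Category.assoc, Pi.lift_π, comp_value]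
    simp only [Pi.lift_π]
    exact value_lift _ α (β k)

/-- The `j`-th projection `D ^ n ⟶ D`. -/
noncomputable abbrev powersπ (D : InternalDL C) (I : Cube) (j : Fin I.dim) :
    D.powers.obj I ⟶ D.obj :=
  Pi.π (fun _ : Fin I.dim => D.obj) j

theorem powers_map_π {I J : Cube} (α : I ⟶ J) (k : Fin J.dim) :
    D.powers.map α ≫ D.powersπ J k = D.value (D.powersπ I) (α k) :=
  Pi.lift_π _ _

theorem comp_powers_map_π {I J : Cube} (α : I ⟶ J) {U : C} (d : U ⟶ D.powers.obj I)
    (k : Fin J.dim) :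
    d ≫ D.powers.map α ≫ D.powersπ J k = D.value (fun j => d ≫ D.powersπ I j) (α k) := by
  rw [powers_map_π, comp_value]

instance isIso_powersπ_one (D : InternalDL C) : IsIso (D.powersπ ⟨1⟩ 0) := by
  refine ⟨Pi.lift fun _ => 𝟙 D.obj, Pi.hom_ext _ _ fun j => ?_, Pi.lift_π _ _⟩
  obtain rfl : j = 0 := Subsingleton.elim (α := Fin 1) _ _
  exact (Category.assoc _ _ _).trans ((congrArg (D.powersπ ⟨1⟩ 0 ≫ ·) (Pi.lift_π _ _)).trans
    ((Category.comp_id _).trans (Category.id_comp _).symm))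

/-- The sieve of those `p : V ⟶ U` along which the tuple `d` is of the form `γ(d')`, with a
substitution `γ` that equalizes `α` and `β`. -/
def freeSieve {n m : ℕ} (α β : Fin n → FreeDL (Fin m)) {U : C} (d : Fin m → (U ⟶ D.obj)) :
    Sieve U where
  arrows V p := ∃ (k : ℕ) (γ : Fin m → FreeDL (Fin k)) (d' : Fin k → (V ⟶ D.obj)),
    (∀ i, FreeDL.lift γ (α i) = FreeDL.lift γ (β i)) ∧ ∀ j, D.value d' (γ j) = p ≫ d j
  downward_closed := by
    rintro V V' p ⟨k, γ, d', h, h'⟩ q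
    exact ⟨k, γ, fun j => q ≫ d' j, h, fun j => by rw [← comp_value, h' j, Category.assoc]⟩

theorem isFlat_iff : D.IsFlat ↔ ∀ (n m : ℕ) (α β : Fin n → FreeDL (Fin m)) (U : C)
    (d : Fin m → (U ⟶ D.obj)), (∀ i, D.value d (α i) = D.value d (β i)) →
      (freeSieve α β d).JointlyEpi :=
  Iff.rfl

theorem pullback_freeSieve_le {n m : ℕ} (α β : Fin n → FreeDL (Fin m)) {U V : C}
    (d : Fin m → (U ⟶ D.obj)) (q : V ⟶ U) :
    (freeSieve α β d).pullback q ≤ freeSieve α β fun j => q ≫ d j := by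
  rintro V' p ⟨k, γ, d', h, h'⟩
  exact ⟨k, γ, d', h, fun j => (h' j).trans (Category.assoc _ _ _)⟩

/-- The universal case of flatness: on the equalizer `E` of `α` and `β` on `D ^ m`. -/
theorem IsFlat.jointlyEpi_equalizer [HasEqualizers C] (hD : D.IsFlat) {I J : Cube} (α β : I ⟶ J) :
    (freeSieve α β fun j => equalizer.ι (D.powers.map α) (D.powers.map β) ≫
      D.powersπ I j).JointlyEpi := by
  refine isFlat_iff.1 hD _ _ _ _ _ _ fun i => ?_
  rw [← comp_powers_map_π, ← comp_powers_map_π, equalizer.condition_assoc]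

end

section Map

variable {C : Type w} [Category.{v} C] {C' : Type w'} [Category.{v} C']

section

variable [HasFiniteProducts C] [HasFiniteProducts C'] (F : C ⥤ C') [PreservesFiniteLimits F]
  (D : InternalDL C)

variable {D} in
/-- The action of a left exact functor on generalized elements. -/
def mapElt {U : C} (a : U ⟶ D.obj) : F.obj U ⟶ (D.map F).obj := F.map a

variable {D} in
theorem mapElt_comp {U V : C} (p : V ⟶ U) (a : U ⟶ D.obj) :
    mapElt F (p ≫ a) = F.map p ≫ mapElt F a :=
  F.map_comp p a

variable {D} in
/-- A left exact functor commutes with lattice polynomials. -/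
theorem mapElt_value {U : C} {n : ℕ} (d : Fin n → (U ⟶ D.obj)) (t : FreeDL (Fin n)) :
    mapElt F (D.value d t) = (D.map F).value (fun i => mapElt F (d i)) t :=
  FreeDL.map_lift (L := D.Elt U) (L' := (D.map F).Elt (F.obj U))
    { toFun := fun a => mapElt F a
      map_inf' := fun a b => by
        have := opApp_mapOp F D.inf (𝟙 (F.obj U)) a b
        simp only [Category.id_comp] at this
        exact this.symm
      map_sup' := fun a b => by
        have := opApp_mapOp F D.sup (𝟙 (F.obj U)) a b
        simp only [Category.id_comp] at this
        exact this.symm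
      map_bot' := by
        have := constApp_mapConst F D.bot (𝟙 (F.obj U))
        simp only [Category.id_comp] at this
        exact this.symm
      map_top' := by
        have := constApp_mapConst F D.top (𝟙 (F.obj U))
        simp only [Category.id_comp] at this
        exact this.symm } d t

theorem functorPushforward_freeSieve_le {n m : ℕ} (α β : Fin n → FreeDL (Fin m)) {U : C}
    (d : Fin m → (U ⟶ D.obj)) :
    (freeSieve α β d).functorPushforward F ≤ freeSieve α β fun j => mapElt F (d j) := by
  rintro _ _ ⟨V, p, q, ⟨k, γ, d', h, h'⟩, rfl⟩
  refine ⟨k, γ, fun j => q ≫ mapElt F (d' j), h, fun j => ?_⟩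
  rw [← comp_value, ← mapElt_value, h' j, mapElt_comp, Category.assoc]

variable {D} in
theorem existsUnique_powers {U : C'} {I : Cube} (d : Fin I.dim → (U ⟶ (D.map F).obj)) :
    ∃! t : U ⟶ F.obj (D.powers.obj I), ∀ j, t ≫ mapElt F (D.powersπ I j) = d j := by
  have h := isLimitOfHasProductOfPreservesLimit F fun _ : Fin I.dim => D.obj
  exact ⟨Fan.IsLimit.lift h d, fun j => Fan.IsLimit.fac h d j, fun t ht =>
    Fan.IsLimit.hom_ext h _ _ fun j => (ht j).trans (Fan.IsLimit.fac h d j).symm⟩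

end

/-- Flatness is preserved by left exact left adjoints. The equalizer of `α` and `β` on `D ^ m`
carries the universal tuple `d` with `α(d) = β(d)`; left exact functors preserve it, left adjoints
preserve the jointly epimorphic sieve on it, and this sieve is pulled back to a given tuple. -/
theorem IsFlat.map {C' : Type w'} [Category.{u} C'] {C : Type w} [Category.{u} C]
    [HasFiniteLimits C] [IsGrothendieckTopos C'] {F : C ⥤ C'}
    [PreservesFiniteLimits F] {G : C' ⥤ C} (adj : F ⊣ G) {D : InternalDL C} (hD : D.IsFlat) :
    (D.map F).IsFlat := by
  refine isFlat_iff.2 fun n m α β U d hd => ?_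
  let I : Cube := ⟨m⟩
  let J : Cube := ⟨n⟩
  let α' : I ⟶ J := α
  let β' : I ⟶ J := β
  obtain ⟨t, ht, -⟩ := existsUnique_powers F (I := I) d
  have key : ∀ (γ : I ⟶ J) (k : Fin n),
      (t ≫ F.map (D.powers.map γ)) ≫ mapElt F (D.powersπ J k) = (D.map F).value d (γ k) := by
    intro γ k
    rw [Category.assoc, ← mapElt_comp, powers_map_π, mapElt_value, comp_value]
    simp only [ht]
  have heq : t ≫ F.map (D.powers.map α') = t ≫ F.map (D.powers.map β') :=
    (existsUnique_powers F (I := J) _).unique (key α') fun k => (key β' k).trans (hd k).symm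
  have hE := isLimitOfHasEqualizerOfPreservesLimit F (D.powers.map α') (D.powers.map β')
  let q : U ⟶ F.obj (equalizer (D.powers.map α') (D.powers.map β')) :=
    Fork.IsLimit.lift hE t heq
  have hq : q ≫ F.map (equalizer.ι _ _) = t := Fork.IsLimit.lift_ι' hE t heq
  have h := ((hD.jointlyEpi_equalizer α' β').functorPushforward adj).pullback q
  refine (h.mono (Sieve.pullback_monotone q (functorPushforward_freeSieve_le F D _ _ _))).mono
    ((pullback_freeSieve_le _ _ _ _).trans (le_of_eq ?_))
  congr 1
  funext j
  rw [mapElt_comp, reassoc_of% hq, ht]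

end Map

end InternalDL

/-! ### The interval and the representable cubical sets -/

theorem isGrothendieckTopos_sheaf {C : Type u} [SmallCategory C] (J : GrothendieckTopology C) :
    IsGrothendieckTopos (Sheaf J (Type u)) :=
  ⟨C, _, J, ⟨CategoryTheory.Equivalence.refl⟩⟩

theorem isGrothendieckTopos_cubicalSet : IsGrothendieckTopos CubicalSet.{u} :=
  ⟨ULiftHom.{u} (ULift.{u} Cube), inferInstance, ⊥,
    ⟨(ULiftHomULiftCategory.equiv.{u, u} Cube).op.congrLeft.trans
      (sheafBotEquivalence (Type u)).symm⟩⟩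

theorem IsGrothendieckTopos.hasColimits (X : Type w) [Category.{u} X]
    [h : IsGrothendieckTopos X] : HasColimitsOfSize.{u, u} X := by
  obtain ⟨C, _, J, ⟨e⟩⟩ := h.exists_site
  have : HasColimitsOfSize.{u, u} (Sheaf J (Type u)) := ⟨fun K _ => inferInstance⟩
  exact Adjunction.has_colimits_of_equivalence e.functor

namespace CubicalSet

/-- The value of a generalized element of the interval, as an element of `DL(n)`. -/
noncomputable def ev {U : CubicalSet.{u}} (a : U ⟶ intervalDL.{u}.obj) {I : Cubeᵒᵖ} (x : U.obj I) :
    FreeDL (Fin I.unop.dim) :=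
  val (NatTrans.app (show U ⟶ interval from a) I x)

theorem ev_ext {U : CubicalSet.{u}} {a b : U ⟶ intervalDL.{u}.obj}
    (h : ∀ (I : Cubeᵒᵖ) (x : U.obj I), ev a x = ev b x) : a = b :=
  hom_interval_ext h

theorem ev_comp {U V : CubicalSet.{u}} (p : V ⟶ U) (a : U ⟶ intervalDL.{u}.obj) {I : Cubeᵒᵖ}
    (x : V.obj I) : ev (p ≫ a) x = ev a (p.app I x) := rfl

theorem ev_map {U : CubicalSet.{u}} (a : U ⟶ intervalDL.{u}.obj) {I J : Cubeᵒᵖ} (f : I ⟶ J)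
    (x : U.obj I) : ev a (U.map f x) = FreeDL.lift f.unop (ev a x) :=
  congrArg val (NatTrans.naturality_apply (show U ⟶ interval from a) f x)

theorem ev_value {U : CubicalSet.{u}} {n : ℕ} (d : Fin n → (U ⟶ intervalDL.{u}.obj))
    (t : FreeDL (Fin n)) {I : Cubeᵒᵖ} (x : U.obj I) :
    ev (intervalDL.{u}.value d t) x = FreeDL.lift (fun j => ev (d j) x) t :=
  FreeDL.map_lift (L := intervalDL.{u}.Elt U)
    { toFun := fun a => ev a x
      map_inf' := fun a b =>
        opApp_intervalOp (fun _ a b => a ⊓ b) (fun _ _ f a b => FreeDL.lift_inf f a b) a b I x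
      map_sup' := fun a b =>
        opApp_intervalOp (fun _ a b => a ⊔ b) (fun _ _ f a b => FreeDL.lift_sup f a b) a b I x
      map_bot' := rfl
      map_top' := rfl } d t

/-- The generic tuple of elements of the interval, on the representable of dimension `n`. -/
noncomputable def coord (I : Cube) (j : Fin I.dim) :
    uliftYoneda.{u}.obj I ⟶ intervalDL.{u}.obj :=
  uliftYonedaEquiv.symm (show interval.{u}.obj (op I) from ULift.up (FreeDL.of j))

/-- The interval is flat: `U` is covered by representables, on which the tuple `d` is obtained
from the generic tuple by a substitution. -/
theorem isFlat_intervalDL : InternalDL.IsFlat intervalDL.{u} := by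
  refine InternalDL.isFlat_iff.2 fun n m α β U d hd W f g hfg => ?_
  ext I x
  have h := hfg (uliftYonedaEquiv.symm x : uliftYoneda.{u}.obj I.unop ⟶ U)
    ⟨I.unop.dim, fun j => ev (d j) x, coord I.unop, fun i => ?_, fun j => ?_⟩
  · have := congrArg uliftYonedaEquiv h
    rw [uliftYonedaEquiv_comp, uliftYonedaEquiv_comp, Equiv.apply_symm_apply] at this
    exact this
  · rw [← ev_value, ← ev_value, hd]
  · refine ev_ext fun K y => ?_
    rw [ev_value, ev_comp]
    exact (ev_map (d j) y.down.op x).symm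

/-- The representable cubical set of dimension `n` is the `n`-th power of the interval. -/
noncomputable def isLimitCoord (I : Cube) : IsLimit (Fan.mk _ (coord.{u} I)) :=
  Fan.IsLimit.mk _
    (fun s =>
      { app := fun K => TypeCat.ofHom fun x => ULift.up fun j => ev (s.proj j) x
        naturality := fun K K' f => ConcreteCategory.hom_ext (C := Type u) _ _ fun x =>
          ULift.down_injective (funext fun j => ev_map (s.proj j) f x) })
    (fun s j => ev_ext fun K x => rfl)
    (fun s m hm => by
      ext K x
      refine ULift.down_injective (funext fun j => ?_)
      exact congrArg (fun a => ev a x) (hm j))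

/-- The isomorphism between a representable cubical set and a power of the interval. -/
noncomputable def yonedaIsoPowersApp (I : Cube) :
    uliftYoneda.{u}.obj I ≅ intervalDL.{u}.powers.obj I :=
  (isLimitCoord I).conePointUniqueUpToIso (limit.isLimit _)

theorem yonedaIsoPowersApp_hom_π (I : Cube) (j : Fin I.dim) :
    (yonedaIsoPowersApp.{u} I).hom ≫ intervalDL.{u}.powersπ I j = coord I j :=
  (isLimitCoord.{u} I).conePointUniqueUpToIso_hom_comp
    (limit.isLimit (Discrete.functor fun _ : Fin I.dim => intervalDL.{u}.obj)) ⟨j⟩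

/-- The Yoneda embedding is `n ↦ 𝕀 ^ n`. -/
noncomputable def yonedaIsoPowers : uliftYoneda.{u} ≅ intervalDL.{u}.powers :=
  NatIso.ofComponents yonedaIsoPowersApp fun {I J} γ => by
    refine Pi.hom_ext _ _ fun k => ?_
    refine (Category.assoc _ _ _).trans (Eq.trans ?_ (Category.assoc _ _ _).symm)
    refine Eq.trans ?_ (InternalDL.comp_powers_map_π γ (yonedaIsoPowersApp.{u} I).hom k).symm
    simp only [yonedaIsoPowersApp_hom_π]
    refine ev_ext fun K x => ?_
    rw [ev_value]
    exact congrArg (fun a => ev a ((uliftYoneda.{u}.map γ).app K x)) (yonedaIsoPowersApp_hom_π J k)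

end CubicalSet

/-! ### Homomorphisms as natural transformations -/

namespace InternalDL

section

variable {C : Type w} [Category.{v} C] [HasFiniteProducts C] {C' : Type w'} [Category.{v} C']
  [HasFiniteProducts C'] {D : InternalDL C} {F G : C ⥤ C'} [PreservesFiniteLimits G]

theorem powers_hom_ext {U : C'} {I : Cube} {s t : U ⟶ G.obj (D.powers.obj I)}
    (h : ∀ j, s ≫ mapElt G (D.powersπ I j) = t ≫ mapElt G (D.powersπ I j)) : s = t :=
  (existsUnique_powers G _).unique h fun _ => rfl

/-- Natural transformations `F ⟶ G` that agree at `D` agree at the powers of `D`. -/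
theorem natTrans_app_powers_eq {σ τ : F ⟶ G} (h : σ.app D.obj = τ.app D.obj) (I : Cube) :
    σ.app (D.powers.obj I) = τ.app (D.powers.obj I) :=
  powers_hom_ext fun j =>
    (σ.naturality (D.powersπ I j)).symm.trans ((congrArg _ h).trans (τ.naturality (D.powersπ I j)))

variable [PreservesFiniteLimits F]

/-- A natural transformation induces a homomorphism between the images of `D`. -/
noncomputable def mapNatTrans (D : InternalDL C) (τ : F ⟶ G) : D.map F ⟶ D.map G :=
  show Hom _ _ from
  { hom := τ.app D.obj
    map_inf := mapOp_app τ D.inf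
    map_sup := mapOp_app τ D.sup
    map_bot := mapConst_app τ D.bot
    map_top := mapConst_app τ D.top }

/-- A homomorphism from `F D` to `G D` extends to a natural transformation between the functors
`F (D ^ n)` and `G (D ^ n)` of `n`, because these are the powers of `F D` and of `G D`. -/
theorem exists_powers_natTrans (h : D.map F ⟶ D.map G) :
    ∃ τ : D.powers ⋙ F ⟶ D.powers ⋙ G, ∀ (I : Cube) (j : Fin I.dim),
      τ.app I ≫ mapElt G (D.powersπ I j) = mapElt F (D.powersπ I j) ≫ Hom.hom h := by
  choose t ht _ using fun I : Cube => existsUnique_powers (D := D) G (I := I)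
    fun j => mapElt F (D.powersπ I j) ≫ Hom.hom h
  refine ⟨{ app := t, naturality := fun I J γ => ?_ }, ht⟩
  refine powers_hom_ext fun k => ?_
  change (F.map (D.powers.map γ) ≫ t J) ≫ _ = (t I ≫ G.map (D.powers.map γ)) ≫ _
  simp only [Category.assoc, ht, ← mapElt_comp]
  rw [← Category.assoc, ← mapElt_comp, powers_map_π, mapElt_value, mapElt_value, value_comp_hom,
    comp_value]
  simp only [ht]

/-- A natural transformation between the functors `F (D ^ n)` and `G (D ^ n)` that extends to a
natural transformation `F ⟶ G` and comes from a homomorphism has this homomorphism as its component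
at `D`. -/
theorem natTrans_app_eq {σ : F ⟶ G} {h : D.map F ⟶ D.map G}
    (H : σ.app (D.powers.obj ⟨1⟩) ≫ mapElt G (D.powersπ ⟨1⟩ 0) =
      mapElt F (D.powersπ ⟨1⟩ 0) ≫ Hom.hom h) : σ.app D.obj = Hom.hom h := by
  exact (cancel_epi (F.map (D.powersπ ⟨1⟩ 0))).1 ((σ.naturality _).trans H)

end

end InternalDL

namespace CubicalSet

variable {X : Type w} [Category.{u} X] [IsGrothendieckTopos X]

/-- A cocontinuous functor on cubical sets is the left Kan extension of its restriction to the
powers of the interval. -/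
instance isLeftKanExtension_powers (F : CubicalSet.{u} ⥤ X)
    [PreservesColimitsOfSize.{0, u} F] :
    F.IsLeftKanExtension (Functor.whiskerRight yonedaIsoPowers.{u}.inv F) := by
  have := IsGrothendieckTopos.hasColimits X
  have : HasColimitsOfSize.{0, u} X := hasColimitsOfSizeShrink.{0, u, u, u} X
  exact Presheaf.isLeftKanExtension_of_preservesColimits.{0} F
    (Functor.isoWhiskerRight yonedaIsoPowers.{u}.symm F)

theorem natTrans_ext_of_powers {F G : CubicalSet.{u} ⥤ X} [PreservesColimitsOfSize.{0, u} F]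
    {σ τ : F ⟶ G} (h : ∀ I, σ.app (intervalDL.{u}.powers.obj I) =
      τ.app (intervalDL.{u}.powers.obj I)) : σ = τ := by
  refine F.hom_ext_of_isLeftKanExtension (Functor.whiskerRight yonedaIsoPowers.{u}.inv F) _ _ ?_
  ext I
  change F.map (yonedaIsoPowers.{u}.inv.app I) ≫ σ.app _ =
    F.map (yonedaIsoPowers.{u}.inv.app I) ≫ τ.app _
  rw [σ.naturality, τ.naturality, h]

theorem exists_natTrans_of_powers {F G : CubicalSet.{u} ⥤ X} [PreservesColimitsOfSize.{0, u} F]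
    (τ : intervalDL.{u}.powers ⋙ F ⟶ intervalDL.{u}.powers ⋙ G) :
    ∃ σ : F ⟶ G, ∀ I, σ.app (intervalDL.{u}.powers.obj I) = τ.app I := by
  let α := Functor.whiskerRight yonedaIsoPowers.{u}.inv F
  let β := τ ≫ Functor.whiskerRight yonedaIsoPowers.{u}.inv G
  refine ⟨F.descOfIsLeftKanExtension α G β, fun I => ?_⟩
  have h : F.map (yonedaIsoPowers.{u}.inv.app I) ≫
      (F.descOfIsLeftKanExtension α G β).app _ =
        τ.app I ≫ G.map (yonedaIsoPowers.{u}.inv.app I) :=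
    F.descOfIsLeftKanExtension_fac_app α G β I
  rw [NatTrans.naturality] at h
  exact (cancel_mono (G.map (yonedaIsoPowers.{u}.inv.app I))).1 h

end CubicalSet

namespace GeomMor

variable (X : Type w) [Category.{u} X] [IsGrothendieckTopos X]

instance preservesColimits_inverse (f : GeomMor X CubicalSet.{u}) :
    PreservesColimitsOfSize.{0, u} f.inverse :=
  f.adj.leftAdjoint_preservesColimits

theorem faithful_pullbackDL :
    (pullbackDL (X := X) CubicalSet.intervalDL.{u}).Faithful where
  map_injective {f g _ _} h :=
    CubicalSet.natTrans_ext_of_powers (F := f.inverse) (G := g.inverse) fun I =>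
      InternalDL.natTrans_app_powers_eq (congrArg InternalDL.Hom.hom h) I

theorem full_pullbackDL : (pullbackDL (X := X) CubicalSet.intervalDL.{u}).Full where
  map_surjective {f g} h := by
    obtain ⟨τ, hτ⟩ := InternalDL.exists_powers_natTrans (F := f.inverse) (G := g.inverse) h
    obtain ⟨σ, hσ⟩ := CubicalSet.exists_natTrans_of_powers τ
    refine ⟨σ, InternalDL.Hom.ext (InternalDL.natTrans_app_eq ?_)⟩
    rw [hσ]
    exact hτ _ _

end GeomMor

/-! ### Sections of the powers of a flat distributive lattice in sheaves -/

section FlatSheaf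

variable {C : Type u} [SmallCategory C] {J : GrothendieckTopology C}
  {D : InternalDL (Sheaf J (Type u))}

namespace InternalDL

theorem existsUnique_section_powers (I : Cube) {s : C} (d : Fin I.dim → D.obj.obj.obj (op s)) :
    ∃! x : (D.powers.obj I).obj.obj (op s), ∀ j, (D.powersπ I j).hom.app _ x = d j := by
  have h := isLimitOfHasProductOfPreservesLimit
    (sheafToPresheaf J (Type u) ⋙ (evaluation _ _).obj (op s)) fun _ : Fin I.dim => D.obj
  let f : PUnit.{u+1} ⟶ (D.powers.obj I).obj.obj (op s) :=
    Fan.IsLimit.lift h fun j => TypeCat.ofHom fun _ => d j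
  have hf : ∀ j, f ≫ (D.powersπ I j).hom.app _ = TypeCat.ofHom fun _ => d j :=
    fun j => Fan.IsLimit.fac h _ j
  refine ⟨f PUnit.unit, fun j => ConcreteCategory.congr_hom (hf j) PUnit.unit, fun x hx => ?_⟩
  have : TypeCat.ofHom (fun _ : PUnit.{u+1} => x) = f :=
    Fan.IsLimit.hom_ext h _ _ fun j => by
      refine Eq.trans ?_ (hf j).symm
      exact ConcreteCategory.hom_ext (C := Type u) _ _ fun _ => hx j
  exact ConcreteCategory.congr_hom this PUnit.unit

theorem powers_section_ext {I : Cube} {s : C} {x y : (D.powers.obj I).obj.obj (op s)}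
    (h : ∀ j, (D.powersπ I j).hom.app _ x = (D.powersπ I j).hom.app _ y) : x = y :=
  (existsUnique_section_powers I _).unique h fun _ => rfl

theorem powers_hom_ext' {U : Sheaf J (Type u)} {I : Cube} {f g : U ⟶ D.powers.obj I}
    (h : ∀ j, f ≫ D.powersπ I j = g ≫ D.powersπ I j) : f = g :=
  Pi.hom_ext _ _ h

theorem powers_map_comp_apply {I K M : Cube} (γ : I ⟶ K) (δ : K ⟶ M) {s : C}
    (x : (D.powers.obj I).obj.obj (op s)) :
    (D.powers.map (γ ≫ δ)).hom.app _ x =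
      (D.powers.map δ).hom.app _ ((D.powers.map γ).hom.app _ x) := by
  rw [D.powers.map_comp]; rfl

theorem powers_map_id_apply {I : Cube} {s : C} (x : (D.powers.obj I).obj.obj (op s)) :
    (D.powers.map (𝟙 I)).hom.app _ x = x := by
  rw [D.powers.map_id]; rfl

/-- Sections of `D ^ m` and of `D ^ n` are the two projections of a section of `D ^ (m + n)`. -/
theorem exists_section_pair {I K : Cube} {s : C} (x : (D.powers.obj I).obj.obj (op s))
    (y : (D.powers.obj K).obj.obj (op s)) :
    ∃ (M : Cube) (fst : M ⟶ I) (snd : M ⟶ K) (z : (D.powers.obj M).obj.obj (op s)),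
      (D.powers.map fst).hom.app _ z = x ∧ (D.powers.map snd).hom.app _ z = y := by
  obtain ⟨z, hz, -⟩ := existsUnique_section_powers (D := D) (s := s) ⟨I.dim + K.dim⟩
    (Fin.append (fun i => (D.powersπ I i).hom.app _ x) fun k => (D.powersπ K k).hom.app _ y)
  refine ⟨⟨I.dim + K.dim⟩, fun i => FreeDL.of (Fin.castAdd K.dim i),
    fun k => FreeDL.of (Fin.natAdd I.dim k), z, powers_section_ext fun i => ?_,
    powers_section_ext fun k => ?_⟩
  · rw [← Sheaf.comp_hom_app_apply, powers_map_π]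
    exact (hz _).trans (Fin.append_left _ _ i)
  · rw [← Sheaf.comp_hom_app_apply, powers_map_π]
    exact (hz _).trans (Fin.append_right _ _ k)

/-- Flatness, for sections: where `α` and `β` agree at a section `x` of `D ^ m`, the section is
locally of the form `γ(c)`, with `γ` equalizing `α` and `β`. -/
theorem IsFlat.exists_local_section (hD : D.IsFlat) {I K : Cube} (α β : I ⟶ K) {s : C}
    (x : (D.powers.obj I).obj.obj (op s))
    (hx : (D.powers.map α).hom.app _ x = (D.powers.map β).hom.app _ x) :
    ∃ T ∈ J s, ∀ ⦃t : C⦄ (f : t ⟶ s), T f →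
      ∃ (M : Cube) (γ : M ⟶ I) (c : (D.powers.obj M).obj.obj (op t)),
        γ ≫ α = γ ≫ β ∧ (D.powers.map γ).hom.app _ c = (D.powers.obj I).obj.map f.op x := by
  have hE := isLimitOfHasEqualizerOfPreservesLimit
    (sheafToPresheaf J (Type u) ⋙ (evaluation _ _).obj (op s)) (D.powers.map α) (D.powers.map β)
  obtain ⟨e, he, -⟩ := Types.unique_of_type_equalizer _ _ hE x hx
  obtain ⟨T, hT, h⟩ := (hD.jointlyEpi_equalizer α β).exists_local_section e
  refine ⟨T, hT, fun t f hf => ?_⟩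
  obtain ⟨V, p, y, ⟨k, γ, d', hγ, hd'⟩, hy⟩ := h f hf
  let M : Cube := ⟨k⟩
  let q : V ⟶ D.powers.obj M := Pi.lift d'
  have hq : ∀ j, q ≫ D.powersπ M j = d' j := fun j => Pi.lift_π _ _
  have hq' : q ≫ D.powers.map (show M ⟶ I from γ) = p ≫ equalizer.ι _ _ :=
    powers_hom_ext' fun j => by
      rw [Category.assoc, comp_powers_map_π]
      simp only [hq]
      exact (hd' j).trans (Category.assoc _ _ _).symm
  refine ⟨M, γ, q.hom.app _ y, funext hγ, ?_⟩
  rw [← Sheaf.comp_hom_app_apply, hq', Sheaf.comp_hom_app_apply, hy, Sheaf.hom_app_map]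
  exact congrArg _ he

end InternalDL

end FlatSheaf

/-! ### Equality of sections of the tensor product with a flat distributive lattice -/

section Refinement

variable {C : Type u} [SmallCategory C] {J : GrothendieckTopology C}

namespace InternalDL

/-- A section over `s` of the coproduct of the `D ^ n`, indexed by the elements of the cubical set
`R`. Such pairs of a section of `D ^ n` and of an `n`-cube of `R` are the formal elements of the
tensor product of `R` with `D`. -/
structure FormalSection (D : InternalDL (Sheaf J (Type u))) (R : CubicalSet.{u}) (s : C) :
    Type u where
  index : Cube
  sec : (D.powers.obj index).obj.obj (op s)
  cube : R.obj (op index)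

namespace FormalSection

variable {D : InternalDL (Sheaf J (Type u))} {R : CubicalSet.{u}}

/-- Restriction of formal sections. -/
noncomputable def restrict {s t : C} (f : t ⟶ s) (a : FormalSection D R s) : FormalSection D R t :=
  ⟨a.index, (D.powers.obj a.index).obj.map f.op a.sec, a.cube⟩

theorem restrict_comp {s t r : C} (f : t ⟶ s) (g : r ⟶ t) (a : FormalSection D R s) :
    a.restrict (g ≫ f) = (a.restrict f).restrict g := by
  simp only [restrict, Sheaf.map_comp_op_apply]
  rfl

theorem restrict_id {s : C} (a : FormalSection D R s) : a.restrict (𝟙 s) = a := by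
  simp [restrict]

/-- Two formal sections have a common refinement: they come from the same section of some `D ^ k`
by substitutions along which their cubes become equal. -/
def Refine {s : C} (a b : FormalSection D R s) : Prop :=
  ∃ (K : Cube) (c : (D.powers.obj K).obj.obj (op s)) (γ : K ⟶ a.index) (δ : K ⟶ b.index),
    (D.powers.map γ).hom.app _ c = a.sec ∧ (D.powers.map δ).hom.app _ c = b.sec ∧
      R.map γ.op a.cube = R.map δ.op b.cube

theorem Refine.restrict {s t : C} {a b : FormalSection D R s} (h : a.Refine b) (f : t ⟶ s) :
    (a.restrict f).Refine (b.restrict f) := by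
  obtain ⟨K, c, γ, δ, h₁, h₂, h₃⟩ := h
  refine ⟨K, (D.powers.obj K).obj.map f.op c, γ, δ, ?_, ?_, h₃⟩
  · exact (Sheaf.hom_app_map (D.powers.map γ) f.op c).trans (congrArg _ h₁)
  · exact (Sheaf.hom_app_map (D.powers.map δ) f.op c).trans (congrArg _ h₂)

/-- The sieve on which two formal sections have a common refinement. -/
def refineSieve {s : C} (a b : FormalSection D R s) : Sieve s where
  arrows t f := (a.restrict f).Refine (b.restrict f)
  downward_closed {t r f} h g := by
    rw [restrict_comp, restrict_comp]
    exact h.restrict g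

theorem pullback_refineSieve {s t : C} (f : t ⟶ s) (a b : FormalSection D R s) :
    (refineSieve a b).pullback f = refineSieve (a.restrict f) (b.restrict f) := by
  ext r g
  change (a.restrict (g ≫ f)).Refine (b.restrict (g ≫ f)) ↔
    ((a.restrict f).restrict g).Refine ((b.restrict f).restrict g)
  rw [restrict_comp, restrict_comp]

theorem Refine.refineSieve_mem {s : C} {a b : FormalSection D R s} (h : a.Refine b) :
    refineSieve a b ∈ J s :=
  J.superset_covering (fun _ f _ => h.restrict f) (J.top_mem s)

/-- The common refinements of `a, b` and of `b, c` give two sections of powers of `D`, and two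
substitutions with the same value `b` at their pair; by flatness, locally these substitutions
become equal after a further refinement. -/
theorem Refine.trans_local (hD : D.IsFlat) {s : C} {a b c : FormalSection D R s}
    (h : a.Refine b) (h' : b.Refine c) : refineSieve a c ∈ J s := by
  obtain ⟨K, x, γ, δ, h₁, h₂, h₃⟩ := h
  obtain ⟨K', x', γ', δ', h₁', h₂', h₃'⟩ := h'
  obtain ⟨M, p, q, z, hp, hq⟩ := exists_section_pair x x'
  obtain ⟨T, hT, H⟩ := hD.exists_local_section (p ≫ δ) (q ≫ γ') z (by
    rw [powers_map_comp_apply, powers_map_comp_apply, hp, hq, h₂, h₁'])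
  refine J.superset_covering (fun t f hf => ?_) hT
  obtain ⟨N, ε, y, hε, hy⟩ := H f hf
  refine ⟨N, y, ε ≫ p ≫ γ, ε ≫ q ≫ δ', ?_, ?_, ?_⟩
  · change (D.powers.map (ε ≫ p ≫ γ)).hom.app _ y = (D.powers.obj a.index).obj.map f.op a.sec
    rw [powers_map_comp_apply, powers_map_comp_apply, hy, Sheaf.hom_app_map, hp,
      Sheaf.hom_app_map, h₁]
  · change (D.powers.map (ε ≫ q ≫ δ')).hom.app _ y = (D.powers.obj c.index).obj.map f.op c.sec
    rw [powers_map_comp_apply, powers_map_comp_apply, hy, Sheaf.hom_app_map, hq,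
      Sheaf.hom_app_map, h₂']
  · change R.map (ε ≫ p ≫ γ).op a.cube = R.map (ε ≫ q ≫ δ').op c.cube
    have e₁ : R.map (ε ≫ p ≫ γ).op a.cube = R.map (ε ≫ p ≫ δ).op b.cube := by
      simp only [op_comp, Functor.map_comp, comp_apply, h₃]
    have e₂ : R.map (ε ≫ q ≫ γ').op b.cube = R.map (ε ≫ q ≫ δ').op c.cube := by
      simp only [op_comp, Functor.map_comp, comp_apply, h₃']
    rw [e₁, hε, e₂]

theorem refineSieve_trans (hD : D.IsFlat) {s : C} {a b c : FormalSection D R s}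
    (h : refineSieve a b ∈ J s) (h' : refineSieve b c ∈ J s) : refineSieve a c ∈ J s := by
  refine J.transitive (J.intersection_covering h h') _ fun t f hf => ?_
  rw [pullback_refineSieve]
  exact Refine.trans_local hD hf.1 hf.2

theorem Refine.refl {s : C} (a : FormalSection D R s) : a.Refine a :=
  ⟨a.index, a.sec, 𝟙 _, 𝟙 _, powers_map_id_apply _, powers_map_id_apply _, rfl⟩

theorem Refine.symm {s : C} {a b : FormalSection D R s} (h : a.Refine b) : b.Refine a := by
  obtain ⟨K, c, γ, δ, h₁, h₂, h₃⟩ := h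
  exact ⟨K, c, δ, γ, h₂, h₁, h₃.symm⟩

/-- Formal sections are identified if they locally have common refinements. -/
def localSetoid (hD : D.IsFlat) (R : CubicalSet.{u}) (s : C) : Setoid (FormalSection D R s) where
  r a b := refineSieve a b ∈ J s
  iseqv :=
    ⟨fun a => (Refine.refl a).refineSieve_mem,
      fun h => J.superset_covering (fun _ _ hf => Refine.symm hf) h,
      fun h h' => refineSieve_trans hD h h'⟩

/-- The presheaf of formal sections up to local refinement. -/
noncomputable def quotientPresheaf (hD : D.IsFlat) (R : CubicalSet.{u}) : Cᵒᵖ ⥤ Type u where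
  obj s := Quotient (localSetoid hD R s.unop)
  map f := TypeCat.ofHom (Quotient.map (restrict f.unop) fun a b h => by
    change refineSieve _ _ ∈ J _
    rw [← pullback_refineSieve]
    exact J.pullback_stable _ h)
  map_id s := ConcreteCategory.hom_ext (C := Type u) _ _ <| by
    rintro ⟨a⟩
    exact congrArg (Quotient.mk _) (restrict_id a)
  map_comp f g := ConcreteCategory.hom_ext (C := Type u) _ _ <| by
    rintro ⟨a⟩
    exact congrArg (Quotient.mk _) (restrict_comp f.unop g.unop a)

/-- The class of a formal section. -/
noncomputable def cls (hD : D.IsFlat) {s : C} (a : FormalSection D R s) :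
    (quotientPresheaf hD R).obj (op s) :=
  Quotient.mk (localSetoid hD R s) a

variable (hD : D.IsFlat) (R) in
/-- The sheaf of formal sections up to local refinement. -/
noncomputable def quotientSheaf : Sheaf J (Type u) :=
  (presheafToSheaf J (Type u)).obj (quotientPresheaf hD R)

/-- For an `n`-cube `r` of `R`, the morphism from `D ^ n` to the quotient which maps `x` to the
class of `(x, r)`. -/
noncomputable def toQuotientSheaf (hD : D.IsFlat) (I : Cube) (r : R.obj (op I)) :
    D.powers.obj I ⟶ quotientSheaf R hD :=
  ⟨{ app := fun s => TypeCat.ofHom fun x =>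
      show (quotientPresheaf hD R).obj s from cls hD ⟨I, x, r⟩
     naturality := fun _ _ _ => rfl } ≫ toSheafify J (quotientPresheaf hD R)⟩

theorem powers_map_comp_toQuotientSheaf (hD : D.IsFlat) {I K : Cube} (γ : K ⟶ I)
    (r : R.obj (op I)) :
    D.powers.map γ ≫ toQuotientSheaf hD I r = toQuotientSheaf hD K (R.map γ.op r) := by
  ext s x
  refine congrArg ((toSheafify J (quotientPresheaf hD R)).app s) (Quotient.sound ?_)
  refine Refine.refineSieve_mem ⟨K, x, γ, 𝟙 K, rfl, powers_map_id_apply x, ?_⟩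
  simp

/-- The quotient sheaf identifies two formal sections only if they locally have common
refinements. -/
theorem refineSieve_mem_of_toQuotientSheaf_eq (hD : D.IsFlat) {s : C} {I K : Cube}
    {x : (D.powers.obj I).obj.obj (op s)} {y : (D.powers.obj K).obj.obj (op s)}
    {r : R.obj (op I)} {q : R.obj (op K)}
    (h : (toQuotientSheaf hD I r).hom.app _ x = (toQuotientSheaf hD K q).hom.app _ y) :
    refineSieve (⟨I, x, r⟩ : FormalSection D R s) ⟨K, y, q⟩ ∈ J s := by
  have h' : (toSheafify J (quotientPresheaf hD R)).app (op s) (cls hD ⟨I, x, r⟩) =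
      (toSheafify J (quotientPresheaf hD R)).app (op s) (cls hD ⟨K, y, q⟩) := h
  refine J.transitive (Presheaf.equalizerSieve_mem J _ _ _ h') _ fun t f hf => ?_
  rw [pullback_refineSieve]
  exact Quotient.exact hf

end FormalSection

end InternalDL

end Refinement

/-! ### The tensor product with an internal distributive lattice -/

namespace InternalDL

section Tensor

variable {X : Type w} [Category.{u} X] [IsGrothendieckTopos X] (D : InternalDL X)

instance hasPointwiseLeftKanExtension_uliftYoneda (A : Cube ⥤ X) :
    uliftYoneda.{u}.HasPointwiseLeftKanExtension A :=
  have := IsGrothendieckTopos.hasColimits X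
  have : HasColimitsOfSize.{0, u} X := hasColimitsOfSizeShrink.{0, u, u, u} X
  inferInstance

/-- The tensor product of cubical sets with `D`: the cocontinuous functor that maps the
representable cubical set of dimension `n` to `D ^ n`. -/
noncomputable def tensor : CubicalSet.{u} ⥤ X :=
  uliftYoneda.{u}.leftKanExtension D.powers

/-- The comparison between `D ^ n` and the tensor product of the representable of dimension `n`
with `D`. -/
noncomputable def tensorUnit : D.powers ⟶ uliftYoneda.{u} ⋙ D.tensor :=
  uliftYoneda.{u}.leftKanExtensionUnit D.powers

instance : D.tensor.IsLeftKanExtension D.tensorUnit :=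
  inferInstanceAs ((uliftYoneda.{u}.leftKanExtension D.powers).IsLeftKanExtension
    (uliftYoneda.{u}.leftKanExtensionUnit D.powers))

instance : IsIso D.tensorUnit := Presheaf.isIso_of_isLeftKanExtension.{0} D.tensor D.tensorUnit

/-- The tensor product with `D` is left adjoint to the functor that maps `x` to the cubical set
of morphisms `D ^ n ⟶ x`. -/
noncomputable def tensorAdj : D.tensor ⊣ Presheaf.restrictedULiftYoneda.{0} D.powers :=
  Presheaf.uliftYonedaAdjunction.{0} D.tensor D.tensorUnit

/-- The value of the tensor product at a representable. -/
noncomputable def tensorYonedaIso (I : Cube) :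
    D.powers.obj I ≅ D.tensor.obj (uliftYoneda.{u}.obj I) :=
  (asIso D.tensorUnit).app I

variable {D}

theorem powers_map_tensorYonedaIso {I K : Cube} (γ : K ⟶ I) :
    D.powers.map γ ≫ (D.tensorYonedaIso I).hom =
      (D.tensorYonedaIso K).hom ≫ D.tensor.map (uliftYoneda.{u}.map γ) :=
  D.tensorUnit.naturality γ

variable (D) in
/-- The morphism `D ^ n ⟶ R ⊗ D` given by an `n`-cube of `R`. -/
noncomputable def tensorIncl {R : CubicalSet.{u}} {I : Cube} (r : R.obj (op I)) :
    D.powers.obj I ⟶ D.tensor.obj R :=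
  (D.tensorYonedaIso I).hom ≫ D.tensor.map (uliftYonedaEquiv.symm r)

theorem powers_map_tensorIncl {R : CubicalSet.{u}} {I K : Cube} (γ : K ⟶ I) (r : R.obj (op I)) :
    D.powers.map γ ≫ D.tensorIncl r = D.tensorIncl (R.map γ.op r) := by
  rw [tensorIncl, ← Category.assoc, powers_map_tensorYonedaIso, Category.assoc,
    ← Functor.map_comp, tensorIncl, uliftYonedaEquiv_symm_map]
  rfl

theorem tensorIncl_map {R S : CubicalSet.{u}} (φ : R ⟶ S) {I : Cube} (r : R.obj (op I)) :
    D.tensorIncl r ≫ D.tensor.map φ = D.tensorIncl (φ.app _ r) := by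
  rw [tensorIncl, Category.assoc, ← Functor.map_comp, tensorIncl]
  congr 2
  apply uliftYonedaEquiv.injective
  rw [uliftYonedaEquiv_comp, Equiv.apply_symm_apply]
  exact (Equiv.apply_symm_apply _ _).symm

theorem tensorAdj_homEquiv_app {R : CubicalSet.{u}} {x : X} (f : D.tensor.obj R ⟶ x) {I : Cubeᵒᵖ}
    (r : R.obj I) :
    (D.tensorAdj.homEquiv R x f).app I r = ULift.up (D.tensorIncl r ≫ f) := by
  refine (Presheaf.uliftYonedaAdjunction_homEquiv_app.{0} D.tensor D.tensorUnit f r).trans ?_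
  exact congrArg ULift.up (Category.assoc _ _ _).symm

theorem tensor_hom_ext {R : CubicalSet.{u}} {x : X} {f g : D.tensor.obj R ⟶ x}
    (h : ∀ (I : Cube) (r : R.obj (op I)), D.tensorIncl r ≫ f = D.tensorIncl r ≫ g) : f = g := by
  apply (D.tensorAdj.homEquiv R x).injective
  refine NatTrans.ext (funext fun I => ConcreteCategory.hom_ext (C := Type u) _ _ fun r => ?_)
  refine (tensorAdj_homEquiv_app f r).trans (Eq.trans ?_ (tensorAdj_homEquiv_app g r).symm)
  exact congrArg ULift.up (h _ r)

theorem exists_tensor_desc {R : CubicalSet.{u}} {x : X}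
    (z : ∀ I : Cube, R.obj (op I) → (D.powers.obj I ⟶ x))
    (hz : ∀ {I K : Cube} (γ : K ⟶ I) (r : R.obj (op I)),
      D.powers.map γ ≫ z I r = z K (R.map γ.op r)) :
    ∃ g : D.tensor.obj R ⟶ x, ∀ (I : Cube) (r : R.obj (op I)), D.tensorIncl r ≫ g = z I r := by
  let g' : R ⟶ (Presheaf.restrictedULiftYoneda.{0} D.powers).obj x :=
    { app := fun I => TypeCat.ofHom fun r => ULift.up (z I.unop r)
      naturality := fun I K f => ConcreteCategory.hom_ext (C := Type u) _ _ fun r =>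
        congrArg ULift.up (hz f.unop r).symm }
  refine ⟨(D.tensorAdj.homEquiv R x).symm g', fun I r => ?_⟩
  have h := tensorAdj_homEquiv_app ((D.tensorAdj.homEquiv R x).symm g') r
  rw [Equiv.apply_symm_apply] at h
  exact (congrArg ULift.down h).symm

end Tensor

section TensorSheaf

variable {C : Type u} [SmallCategory C] {J : GrothendieckTopology C}

instance : IsGrothendieckTopos (Sheaf J (Type u)) := isGrothendieckTopos_sheaf J

variable {D : InternalDL (Sheaf J (Type u))} {R : CubicalSet.{u}}

/-- Sections of `R ⊗ D` are locally given by formal sections. -/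
theorem exists_local_tensorIncl {s : C} (w : (D.tensor.obj R).obj.obj (op s)) :
    ∃ T ∈ J s, ∀ ⦃t : C⦄ (f : t ⟶ s), T f →
      ∃ (I : Cube) (r : R.obj (op I)) (x : (D.powers.obj I).obj.obj (op t)),
        (D.tensorIncl r).hom.app _ x = (D.tensor.obj R).obj.map f.op w := by
  let S : Sieve (D.tensor.obj R) :=
    { arrows := fun V p => ∃ (I : Cube) (r : R.obj (op I)) (q : V ⟶ D.powers.obj I),
        q ≫ D.tensorIncl r = p
      downward_closed := by
        rintro V V' _ ⟨I, r, q, rfl⟩ g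
        exact ⟨I, r, g ≫ q, Category.assoc _ _ _⟩ }
  have hS : S.JointlyEpi := fun W f g h =>
    tensor_hom_ext fun I r => h _ ⟨I, r, 𝟙 _, Category.id_comp _⟩
  obtain ⟨T, hT, h⟩ := hS.exists_local_section w
  refine ⟨T, hT, fun t f hf => ?_⟩
  obtain ⟨V, _, y, ⟨I, r, q, rfl⟩, hy⟩ := h f hf
  exact ⟨I, r, q.hom.app _ y, hy⟩

/-- For flat `D`, two formal sections that agree in `R ⊗ D` locally have common refinements,
because `R ⊗ D` maps to the sheaf of formal sections up to local refinement. -/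
theorem IsFlat.exists_local_refinement (hD : D.IsFlat) {s : C} {I K : Cube}
    {x : (D.powers.obj I).obj.obj (op s)} {y : (D.powers.obj K).obj.obj (op s)}
    {r : R.obj (op I)} {q : R.obj (op K)}
    (h : (D.tensorIncl r).hom.app _ x = (D.tensorIncl q).hom.app _ y) :
    ∃ T ∈ J s, ∀ ⦃t : C⦄ (f : t ⟶ s), T f →
      ∃ (M : Cube) (c : (D.powers.obj M).obj.obj (op t)) (γ : M ⟶ I) (δ : M ⟶ K),
        (D.powers.map γ).hom.app _ c = (D.powers.obj I).obj.map f.op x ∧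
        (D.powers.map δ).hom.app _ c = (D.powers.obj K).obj.map f.op y ∧
        R.map γ.op r = R.map δ.op q := by
  obtain ⟨g, hg⟩ := exists_tensor_desc (D := D) (R := R) (x := FormalSection.quotientSheaf R hD)
    (fun I r => FormalSection.toQuotientSheaf hD I r)
    (fun γ r => FormalSection.powers_map_comp_toQuotientSheaf hD γ r)
  have h' := congrArg (fun a => g.hom.app _ a) h
  simp only [← Sheaf.comp_hom_app_apply, hg] at h'
  exact ⟨_, FormalSection.refineSieve_mem_of_toQuotientSheaf_eq hD h', fun t f hf => hf⟩

/-- The special case of two cubes with the same section of `D ^ n`: here a single substitution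
suffices. -/
theorem IsFlat.exists_local_equalizing (hD : D.IsFlat) {s : C} {I : Cube}
    {x : (D.powers.obj I).obj.obj (op s)} {r q : R.obj (op I)}
    (h : (D.tensorIncl r).hom.app _ x = (D.tensorIncl q).hom.app _ x) :
    ∃ T ∈ J s, ∀ ⦃t : C⦄ (f : t ⟶ s), T f →
      ∃ (M : Cube) (c : (D.powers.obj M).obj.obj (op t)) (γ : M ⟶ I),
        (D.powers.map γ).hom.app _ c = (D.powers.obj I).obj.map f.op x ∧
        R.map γ.op r = R.map γ.op q := by
  let P {t : C} (f : t ⟶ s) : Prop :=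
    ∃ (M : Cube) (c : (D.powers.obj M).obj.obj (op t)) (γ : M ⟶ I),
        (D.powers.map γ).hom.app _ c = (D.powers.obj I).obj.map f.op x ∧
        R.map γ.op r = R.map γ.op q
  let S : Sieve s :=
    { arrows := fun t f => P f
      downward_closed := by
        rintro t t' f ⟨M, c, γ, h₁, h₂⟩ g
        refine ⟨M, (D.powers.obj M).obj.map g.op c, γ, ?_, h₂⟩
        rw [Sheaf.hom_app_map, h₁, Sheaf.map_comp_op_apply] }
  refine ⟨S, ?_, fun t f hf => hf⟩
  obtain ⟨T, hT, H⟩ := hD.exists_local_refinement h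
  refine J.transitive hT _ fun t f hf => ?_
  obtain ⟨M, c, γ, δ, h₁, h₂, h₃⟩ := H f hf
  obtain ⟨T', hT', H'⟩ := hD.exists_local_section γ δ c (h₁.trans h₂.symm)
  refine J.superset_covering (fun t' g hg => ?_) hT'
  obtain ⟨N, ε, b, hε, hb⟩ := H' g hg
  refine ⟨N, b, ε ≫ γ, ?_, ?_⟩
  · rw [powers_map_comp_apply, hb, Sheaf.hom_app_map, h₁, ← Sheaf.map_comp_op_apply]
  · have e : R.map (ε ≫ γ).op r = R.map (ε ≫ δ).op q := by
      simp only [op_comp, Functor.map_comp, comp_apply, h₃]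
    rw [e, hε]

end TensorSheaf

end InternalDL

/-! ### Left exactness of the tensor product with a flat distributive lattice -/

namespace CategoryTheory

variable {C : Type u} [SmallCategory C] {J : GrothendieckTopology C}

theorem Sheaf.imageSieve_mem_of_local {F G : Sheaf J (Type u)} (h : F ⟶ G) {s : C}
    {y : G.obj.obj (op s)} {T : Sieve s} (hT : T ∈ J s)
    (H : ∀ ⦃t : C⦄ (f : t ⟶ s), T f → Presheaf.imageSieve h.hom (G.obj.map f.op y) ∈ J t) :
    Presheaf.imageSieve h.hom y ∈ J s := by
  refine J.transitive hT _ fun t f hf => ?_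
  rw [Presheaf.pullback_imageSieve]
  exact H f hf

theorem Sheaf.isIso_of_injective_of_imageSieve_mem {F G : Sheaf J (Type u)} (h : F ⟶ G)
    (hinj : ∀ (s : C) (x y : F.obj.obj (op s)), h.hom.app _ x = h.hom.app _ y → x = y)
    (hsurj : ∀ (s : C) (y : G.obj.obj (op s)), Presheaf.imageSieve h.hom y ∈ J s) : IsIso h := by
  have : Mono h := Sheaf.mono_of_injective h fun s x y hxy => hinj s.unop x y hxy
  have : Sheaf.IsLocallySurjective h := ⟨fun {s} y => hsurj s y⟩
  exact isIso_of_mono_of_epi h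

end CategoryTheory

namespace InternalDL

variable {C : Type u} [SmallCategory C] {J : GrothendieckTopology C}
  {D : InternalDL (Sheaf J (Type u))}

theorem tensor_map_tensorIncl_apply {R S : CubicalSet.{u}} (φ : R ⟶ S) {I : Cube}
    (r : R.obj (op I)) {s : C} (x : (D.powers.obj I).obj.obj (op s)) :
    (D.tensor.map φ).hom.app _ ((D.tensorIncl r).hom.app _ x) =
      (D.tensorIncl (φ.app _ r)).hom.app _ x := by
  rw [← Sheaf.comp_hom_app_apply, tensorIncl_map]

theorem tensorIncl_powers_map_apply {R : CubicalSet.{u}} {I K : Cube} (γ : K ⟶ I)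
    (r : R.obj (op I)) {s : C} (x : (D.powers.obj K).obj.obj (op s)) :
    (D.tensorIncl r).hom.app _ ((D.powers.map γ).hom.app _ x) =
      (D.tensorIncl (R.map γ.op r)).hom.app _ x := by
  rw [← Sheaf.comp_hom_app_apply, powers_map_tensorIncl]

section

variable {P Q R : CubicalSet.{u}} (f : P ⟶ R) (g : Q ⟶ R)

/-- Sections of the tensor product with a pullback are determined by their two components. -/
theorem IsFlat.tensor_pullback_section_ext (hD : D.IsFlat) {s : C}
    {w w' : (D.tensor.obj (pullback f g)).obj.obj (op s)}
    (h₁ : (D.tensor.map (pullback.fst f g)).hom.app _ w =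
      (D.tensor.map (pullback.fst f g)).hom.app _ w')
    (h₂ : (D.tensor.map (pullback.snd f g)).hom.app _ w =
      (D.tensor.map (pullback.snd f g)).hom.app _ w') : w = w' := by
  -- Locally, both sections are given by formal sections,
  obtain ⟨T₁, hT₁, H₁⟩ := exists_local_tensorIncl w
  refine Sheaf.section_ext _ hT₁ fun s₁ f₁ hf₁ => ?_
  obtain ⟨I, r, x, hx⟩ := H₁ f₁ hf₁
  replace h₁ := congrArg ((D.tensor.obj _).obj.map f₁.op) h₁
  replace h₂ := congrArg ((D.tensor.obj _).obj.map f₁.op) h₂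
  rw [← Sheaf.hom_app_map, ← Sheaf.hom_app_map, ← hx] at h₁ h₂
  rw [← hx]
  generalize (D.tensor.obj (pullback f g)).obj.map f₁.op w' = w' at *
  clear hx H₁ hf₁ hT₁ T₁
  obtain ⟨T₂, hT₂, H₂⟩ := exists_local_tensorIncl w'
  refine Sheaf.section_ext _ hT₂ fun s₂ f₂ hf₂ => ?_
  obtain ⟨I', r', x', hx'⟩ := H₂ f₂ hf₂
  replace h₁ := congrArg ((D.tensor.obj _).obj.map f₂.op) h₁
  replace h₂ := congrArg ((D.tensor.obj _).obj.map f₂.op) h₂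
  rw [← Sheaf.hom_app_map, ← Sheaf.hom_app_map, ← Sheaf.hom_app_map, ← hx'] at h₁ h₂
  rw [← hx', ← Sheaf.hom_app_map]
  generalize (D.powers.obj I).obj.map f₂.op x = x at *
  clear hx' H₂ hf₂ hT₂ T₂
  -- which may be refined to have the same section of `D ^ n`, and cubes with the same first
  -- component,
  rw [tensor_map_tensorIncl_apply, tensor_map_tensorIncl_apply] at h₁
  obtain ⟨T₃, hT₃, H₃⟩ := hD.exists_local_refinement h₁
  refine Sheaf.section_ext _ hT₃ fun s₃ f₃ hf₃ => ?_
  obtain ⟨K, c, γ, δ, hγ, hδ, e₁⟩ := H₃ f₃ hf₃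
  replace h₂ := congrArg ((D.tensor.obj _).obj.map f₃.op) h₂
  rw [← Sheaf.hom_app_map, ← Sheaf.hom_app_map, ← Sheaf.hom_app_map, ← Sheaf.hom_app_map, ← hγ,
    ← hδ, tensorIncl_powers_map_apply, tensorIncl_powers_map_apply] at h₂
  rw [← Sheaf.hom_app_map, ← Sheaf.hom_app_map, ← hγ, ← hδ, tensorIncl_powers_map_apply,
    tensorIncl_powers_map_apply]
  rw [← NatTrans.naturality_apply, ← NatTrans.naturality_apply] at e₁
  generalize (pullback f g).map γ.op r = r at *
  generalize (pullback f g).map δ.op r' = r' at *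
  -- and once more to make the second components equal.
  rw [tensor_map_tensorIncl_apply, tensor_map_tensorIncl_apply] at h₂
  obtain ⟨T₄, hT₄, H₄⟩ := hD.exists_local_equalizing h₂
  refine Sheaf.section_ext _ hT₄ fun s₄ f₄ hf₄ => ?_
  obtain ⟨M, b, ε, hε, e₂⟩ := H₄ f₄ hf₄
  rw [← Sheaf.hom_app_map, ← Sheaf.hom_app_map, ← hε, tensorIncl_powers_map_apply,
    tensorIncl_powers_map_apply]
  refine congrArg (fun r => (D.tensorIncl r).hom.app _ b) (Types.ext_of_isPullback
    ((IsPullback.of_hasPullback f g).map ((evaluation _ _).obj (op M))) ?_ ?_)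
  · refine (NatTrans.naturality_apply (pullback.fst f g) ε.op r).trans (Eq.trans ?_
      (NatTrans.naturality_apply (pullback.fst f g) ε.op r').symm)
    exact congrArg _ e₁
  · refine (NatTrans.naturality_apply (pullback.snd f g) ε.op r).trans (Eq.trans e₂
      (NatTrans.naturality_apply (pullback.snd f g) ε.op r').symm)

/-- Matching sections of the tensor products with `P` and `Q` locally come from the tensor product
with the pullback. -/
theorem IsFlat.imageSieve_pullbackComparison_mem (hD : D.IsFlat) {s : C}
    (τ : (pullback (D.tensor.map f) (D.tensor.map g)).obj.obj (op s)) :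
    Presheaf.imageSieve (pullbackComparison D.tensor f g).hom τ ∈ J s := by
  have hT := IsPullback.of_hasPullback (D.tensor.map f) (D.tensor.map g)
  obtain ⟨T₁, hT₁, H₁⟩ := exists_local_tensorIncl ((pullback.fst _ _ :
    pullback (D.tensor.map f) (D.tensor.map g) ⟶ _).hom.app _ τ)
  refine Sheaf.imageSieve_mem_of_local _ hT₁ fun s₁ f₁ hf₁ => ?_
  obtain ⟨I, p, x, hx⟩ := H₁ f₁ hf₁
  rw [← Sheaf.hom_app_map] at hx
  generalize (pullback (D.tensor.map f) (D.tensor.map g)).obj.map f₁.op τ = τ at *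
  obtain ⟨T₂, hT₂, H₂⟩ := exists_local_tensorIncl ((pullback.snd _ _ :
    pullback (D.tensor.map f) (D.tensor.map g) ⟶ _).hom.app _ τ)
  refine Sheaf.imageSieve_mem_of_local _ hT₂ fun s₂ f₂ hf₂ => ?_
  obtain ⟨K, q, y, hy⟩ := H₂ f₂ hf₂
  replace hx := congrArg ((D.tensor.obj _).obj.map f₂.op) hx
  rw [← Sheaf.hom_app_map, ← Sheaf.hom_app_map] at hx
  rw [← Sheaf.hom_app_map] at hy
  generalize (pullback (D.tensor.map f) (D.tensor.map g)).obj.map f₂.op τ = τ at *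
  generalize (D.powers.obj I).obj.map f₂.op x = x at *
  have h : (D.tensorIncl (f.app _ p)).hom.app _ x = (D.tensorIncl (g.app _ q)).hom.app _ y := by
    rw [← tensor_map_tensorIncl_apply, ← tensor_map_tensorIncl_apply, hx, hy,
      ← Sheaf.comp_hom_app_apply, ← Sheaf.comp_hom_app_apply, pullback.condition]
  obtain ⟨T₃, hT₃, H₃⟩ := hD.exists_local_refinement h
  refine J.superset_covering (fun s₃ f₃ hf₃ => ?_) hT₃
  obtain ⟨M, c, γ, δ, hγ, hδ, e⟩ := H₃ f₃ hf₃
  rw [← NatTrans.naturality_apply, ← NatTrans.naturality_apply] at e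
  obtain ⟨r, hr₁, hr₂⟩ := Types.exists_of_isPullback
    ((IsPullback.of_hasPullback f g).map ((evaluation _ _).obj (op M))) _ _ e
  refine ⟨(D.tensorIncl r).hom.app _ c, Sheaf.section_ext_of_isPullback hT ?_ ?_⟩
  · rw [← Sheaf.comp_hom_app_apply, pullbackComparison_comp_fst, tensor_map_tensorIncl_apply,
      Sheaf.hom_app_map, ← hx, ← Sheaf.hom_app_map, ← hγ, tensorIncl_powers_map_apply]
    exact congrArg (fun r => (D.tensorIncl r).hom.app _ c) hr₁
  · rw [← Sheaf.comp_hom_app_apply, pullbackComparison_comp_snd, tensor_map_tensorIncl_apply,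
      Sheaf.hom_app_map, ← hy, ← Sheaf.hom_app_map, ← hδ, tensorIncl_powers_map_apply]
    exact congrArg (fun r => (D.tensorIncl r).hom.app _ c) hr₂

theorem IsFlat.isIso_pullbackComparison (hD : D.IsFlat) :
    IsIso (pullbackComparison D.tensor f g) := by
  refine Sheaf.isIso_of_injective_of_imageSieve_mem _ (fun s w w' h => ?_) fun s τ =>
    hD.imageSieve_pullbackComparison_mem f g τ
  refine hD.tensor_pullback_section_ext f g ?_ ?_
  · rw [← pullbackComparison_comp_fst, Sheaf.comp_hom_app_apply, h]; rfl
  · rw [← pullbackComparison_comp_snd, Sheaf.comp_hom_app_apply, h]; rfl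

end

end InternalDL

/-- The representable cubical set of dimension `0` is terminal. -/
noncomputable def CubicalSet.isTerminalYonedaZero : IsTerminal (uliftYoneda.{u}.obj (⟨0⟩ : Cube)) :=
  IsTerminal.ofUniqueHom
    (fun U => { app := fun I => TypeCat.ofHom fun _ => ULift.up (Fin.elim0 : Fin 0 → _)
                naturality := fun _ _ _ => ConcreteCategory.hom_ext (C := Type u) _ _ fun _ =>
                  ULift.down_injective (funext fun i => i.elim0) })
    fun U m => by
      ext I x
      exact ULift.down_injective (funext fun i => Fin.elim0 i)

namespace InternalDL

/-- The zeroth power of `D` is terminal. -/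
noncomputable def isTerminalPowersZero {X : Type w} [Category.{v} X] [HasFiniteProducts X]
    (D : InternalDL X) : IsTerminal (D.powers.obj ⟨0⟩) :=
  IsTerminal.ofUniqueHom (fun _ => Pi.lift fun i : Fin 0 => i.elim0)
    fun _ _ => Pi.hom_ext _ _ fun i => Fin.elim0 i

/-- The tensor product with a flat distributive lattice is left exact. -/
theorem IsFlat.preservesFiniteLimits_tensor {C : Type u} [SmallCategory C]
    {J : GrothendieckTopology C} {D : InternalDL (Sheaf J (Type u))} (hD : D.IsFlat) :
    PreservesFiniteLimits D.tensor := by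
  have : PreservesLimit (Functor.empty.{0} CubicalSet.{u}) D.tensor :=
    preservesTerminal_of_iso D.tensor
      (D.tensor.mapIso (terminalIsTerminal.uniqueUpToIso CubicalSet.isTerminalYonedaZero) ≪≫
        (D.tensorYonedaIso ⟨0⟩).symm ≪≫ D.isTerminalPowersZero.uniqueUpToIso terminalIsTerminal)
  have : PreservesLimitsOfShape (Discrete PEmpty.{1}) D.tensor :=
    preservesLimitsOfShape_pempty_of_preservesTerminal _
  have : PreservesLimitsOfShape WalkingCospan D.tensor := ⟨fun {K} => by
    have := hD.isIso_pullbackComparison (K.map WalkingCospan.Hom.inl) (K.map WalkingCospan.Hom.inr)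
    have := PreservesPullback.of_iso_comparison (G := D.tensor)
      (f := K.map WalkingCospan.Hom.inl) (g := K.map WalkingCospan.Hom.inr)
    exact preservesLimit_of_iso_diagram D.tensor (diagramIsoCospan K).symm⟩
  exact preservesFiniteLimits_of_preservesTerminal_and_pullbacks D.tensor

end InternalDL

/-! ### The tensor product of the interval with a flat distributive lattice -/

namespace InternalDL

section

variable {X : Type w} [Category.{u} X] [IsGrothendieckTopos X] (D : InternalDL X)

/-- The evaluation morphism `𝕀 ⊗ D ⟶ D`, which maps `(d, t)` to `t(d)`. -/
theorem exists_tensorEval :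
    ∃ φ : D.tensor.obj CubicalSet.intervalDL.{u}.obj ⟶ D.obj,
      ∀ (U : CubicalSet.{u}) (a : U ⟶ CubicalSet.intervalDL.{u}.obj) (I : Cube)
        (r : U.obj (op I)),
        D.tensorIncl r ≫ D.tensor.map a ≫ φ = D.value (D.powersπ I) (CubicalSet.ev a r) := by
  obtain ⟨φ, hφ⟩ := exists_tensor_desc (D := D) (R := CubicalSet.interval.{u})
    (fun I t => D.value (D.powersπ I) (CubicalSet.val t)) fun {I K} γ t => by
      rw [comp_value]
      simp only [powers_map_π]
      exact (value_lift _ γ _).symm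
  refine ⟨φ, fun U a I r => ?_⟩
  have h := tensorIncl_map (D := D) (show U ⟶ CubicalSet.interval from a) r
  exact (Category.assoc _ _ _).symm.trans ((congrArg (· ≫ φ) h).trans (hφ I _))

/-- If the tensor product is left exact, the evaluation morphism is an isomorphism of distributive
lattices. -/
theorem nonempty_tensor_interval_iso [PreservesFiniteLimits D.tensor] :
    Nonempty (CubicalSet.intervalDL.{u}.map D.tensor ≅ D) := by
  obtain ⟨φ, hφ⟩ := D.exists_tensorEval
  have hinf : ∀ {V : CubicalSet.{u}} (x y : V ⟶ CubicalSet.intervalDL.{u}.obj),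
      D.tensor.map (opApp CubicalSet.intervalDL.{u}.inf x y) ≫ φ =
        opApp D.inf (D.tensor.map x ≫ φ) (D.tensor.map y ≫ φ) := fun x y =>
    tensor_hom_ext fun I r => by
      rw [hφ, comp_opApp, hφ, hφ, ← value_inf]
      exact congrArg _ (CubicalSet.opApp_intervalOp (fun _ a b => a ⊓ b)
        (fun _ _ f a b => FreeDL.lift_inf f a b) x y (op I) r)
  have hsup : ∀ {V : CubicalSet.{u}} (x y : V ⟶ CubicalSet.intervalDL.{u}.obj),
      D.tensor.map (opApp CubicalSet.intervalDL.{u}.sup x y) ≫ φ =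
        opApp D.sup (D.tensor.map x ≫ φ) (D.tensor.map y ≫ φ) := fun x y =>
    tensor_hom_ext fun I r => by
      rw [hφ, comp_opApp, hφ, hφ, ← value_sup]
      exact congrArg _ (CubicalSet.opApp_intervalOp (fun _ a b => a ⊔ b)
        (fun _ _ f a b => FreeDL.lift_sup f a b) x y (op I) r)
  have hbot : D.tensor.map (constApp CubicalSet.intervalDL.{u}.bot (⊤_ _)) ≫ φ =
      constApp D.bot _ :=
    tensor_hom_ext fun I r => by rw [hφ, comp_constApp, ← value_bot (D.powersπ I)]; rfl
  have htop : D.tensor.map (constApp CubicalSet.intervalDL.{u}.top (⊤_ _)) ≫ φ =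
      constApp D.top _ :=
    tensor_hom_ext fun I r => by rw [hφ, comp_constApp, ← value_top (D.powersπ I)]; rfl
  let h : CubicalSet.intervalDL.{u}.map D.tensor ⟶ D := homMk φ
    (fun a b => by
      obtain ⟨V, w, x, y, -, rfl, rfl, -⟩ := exists_three D.tensor a b b
      have e := (congrArg (w ≫ ·) (hinf x y)).trans (comp_opApp w D.inf _ _)
      simp only [← Category.assoc] at e
      exact (congrArg (· ≫ φ) (opApp_mapOp D.tensor _ w x y)).trans e)
    (fun a b => by
      obtain ⟨V, w, x, y, -, rfl, rfl, -⟩ := exists_three D.tensor a b b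
      have e := (congrArg (w ≫ ·) (hsup x y)).trans (comp_opApp w D.sup _ _)
      simp only [← Category.assoc] at e
      exact (congrArg (· ≫ φ) (opApp_mapOp D.tensor _ w x y)).trans e)
    (fun U => by
      let w : U ⟶ D.tensor.obj (⊤_ _) := terminal.from U ≫ inv (terminalComparison D.tensor)
      have e := (congrArg (w ≫ ·) hbot).trans (comp_constApp w D.bot)
      simp only [← Category.assoc] at e
      exact (congrArg (· ≫ φ) (constApp_mapConst D.tensor _ w)).trans e)
    (fun U => by
      let w : U ⟶ D.tensor.obj (⊤_ _) := terminal.from U ≫ inv (terminalComparison D.tensor)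
      have e := (congrArg (w ≫ ·) htop).trans (comp_constApp w D.top)
      simp only [← Category.assoc] at e
      exact (congrArg (· ≫ φ) (constApp_mapConst D.tensor _ w)).trans e)
  -- The interval is represented by its generic element, so that `𝕀 ⊗ D` is `D ^ 1`.
  have hcoord : IsIso (CubicalSet.coord.{u} ⟨1⟩ 0) := by
    rw [← CubicalSet.yonedaIsoPowersApp_hom_π]
    exact IsIso.comp_isIso
  have e : (D.tensorYonedaIso ⟨1⟩).hom ≫ D.tensor.map (CubicalSet.coord.{u} ⟨1⟩ 0) ≫ φ =
      D.powersπ ⟨1⟩ 0 := by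
    have := hφ _ (𝟙 _) ⟨1⟩ (show CubicalSet.interval.{u}.obj (op ⟨1⟩) from
      ULift.up (FreeDL.of 0))
    rw [CategoryTheory.Functor.map_id, Category.id_comp] at this
    exact (Category.assoc _ _ _).symm.trans this
  have : IsIso φ := by
    have h₁ : IsIso ((D.tensorYonedaIso ⟨1⟩).hom ≫
        D.tensor.map (CubicalSet.coord.{u} ⟨1⟩ 0) ≫ φ) := by
      rw [e]; infer_instance
    have h₂ := IsIso.of_isIso_comp_left (D.tensorYonedaIso ⟨1⟩).hom
      (D.tensor.map (CubicalSet.coord.{u} ⟨1⟩ 0) ≫ φ)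
    exact IsIso.of_isIso_comp_left (D.tensor.map (CubicalSet.coord.{u} ⟨1⟩ 0)) φ
  have : IsIso (Hom.hom h) := this
  have := isIso_of_isIso_hom h
  exact ⟨asIso h⟩

end

/-! ### Functoriality of the image of a distributive lattice -/

section

variable {C : Type w} [Category.{v} C] [HasFiniteProducts C] {C' : Type w'} [Category.{v} C']
  [HasFiniteProducts C']

variable {F G : C ⥤ C'} [PreservesFiniteLimits F] [PreservesFiniteLimits G] in
/-- Isomorphic left exact functors have isomorphic values at `D`. -/
theorem nonempty_map_iso_of_iso (D : InternalDL C) (η : F ≅ G) :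
    Nonempty (D.map F ≅ D.map G) := by
  have : IsIso (Hom.hom (D.mapNatTrans η.hom)) := inferInstanceAs (IsIso (η.hom.app D.obj))
  have := isIso_of_isIso_hom (D.mapNatTrans η.hom)
  exact ⟨asIso (D.mapNatTrans η.hom)⟩

theorem mapOp_id {A : C} (m : A ⨯ A ⟶ A) : mapOp (𝟭 C) m = m := by
  rw [mapOp, IsIso.inv_comp_eq]
  have : prodComparison (𝟭 C) A A = 𝟙 _ := by
    apply prod.hom_ext <;> simp [prodComparison]
  rw [this]
  exact (Category.id_comp m).symm

theorem mapConst_id {A : C} (c : ⊤_ C ⟶ A) : mapConst (𝟭 C) c = c := by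
  rw [mapConst, IsIso.inv_comp_eq, Subsingleton.elim (terminalComparison (𝟭 C)) (𝟙 _)]
  exact (Category.id_comp c).symm

theorem comp_id_eq_map_id_comp {A : C} {m m' : A ⨯ A ⟶ A} (h : m = m') :
    m ≫ 𝟙 A = prod.map (𝟙 A) (𝟙 A) ≫ m' := by
  rw [h, prod.map_id_id, Category.comp_id, Category.id_comp]

theorem nonempty_map_id_iso (D : InternalDL C) : Nonempty (D.map (𝟭 C) ≅ D) := by
  let h : D.map (𝟭 C) ⟶ D := show Hom _ _ from
    { hom := 𝟙 D.obj
      map_inf := comp_id_eq_map_id_comp (mapOp_id _)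
      map_sup := comp_id_eq_map_id_comp (mapOp_id _)
      map_bot := (Category.comp_id _).trans (mapConst_id _)
      map_top := (Category.comp_id _).trans (mapConst_id _) }
  have : IsIso (Hom.hom h) := inferInstanceAs (IsIso (𝟙 D.obj))
  have := isIso_of_isIso_hom h
  exact ⟨asIso h⟩

variable {C'' : Type*} [Category.{v} C''] (F : C ⥤ C') (G : C' ⥤ C'')
  [PreservesFiniteLimits F] [PreservesFiniteLimits G] [PreservesFiniteLimits (F ⋙ G)]

theorem mapOp_comp {A : C} (m : A ⨯ A ⟶ A) : mapOp (F ⋙ G) m = mapOp G (mapOp F m) := by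
  rw [mapOp, IsIso.inv_comp_eq, prodComparison_comp, mapOp, Category.assoc,
    IsIso.hom_inv_id_assoc, ← G.map_comp, mapOp, IsIso.hom_inv_id_assoc]
  rfl

variable [HasFiniteProducts C'']

theorem mapConst_comp {A : C} (c : ⊤_ C ⟶ A) :
    mapConst (F ⋙ G) c = mapConst G (mapConst F c) := by
  have : terminalComparison (F ⋙ G) = G.map (terminalComparison F) ≫ terminalComparison G :=
    Subsingleton.elim _ _
  rw [mapConst, IsIso.inv_comp_eq, this, mapConst, Category.assoc,
    IsIso.hom_inv_id_assoc, ← G.map_comp, mapConst, IsIso.hom_inv_id_assoc]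
  rfl

/-- The comparison between the image under a composite and the iterated image, which is the
identity on underlying objects. -/
noncomputable def mapCompHom (D : InternalDL C) : D.map (F ⋙ G) ⟶ (D.map F).map G :=
  show Hom _ _ from
  { hom := 𝟙 (G.obj (F.obj D.obj))
    map_inf := comp_id_eq_map_id_comp (mapOp_comp F G _)
    map_sup := comp_id_eq_map_id_comp (mapOp_comp F G _)
    map_bot := (Category.comp_id _).trans (mapConst_comp F G _)
    map_top := (Category.comp_id _).trans (mapConst_comp F G _) }

instance (D : InternalDL C) : IsIso (mapCompHom F G D) := by
  have : IsIso (Hom.hom (mapCompHom F G D)) :=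
    inferInstanceAs (IsIso (𝟙 (G.obj (F.obj D.obj))))
  exact isIso_of_isIso_hom _

/-- The image under a composite is the iterated image. -/
noncomputable def mapCompIso (D : InternalDL C) : D.map (F ⋙ G) ≅ (D.map F).map G :=
  asIso (mapCompHom F G D)

end

end InternalDL

/-! ### The classifying topos -/

namespace GeomMor

/-- The inverse image functor of a composite of geometric morphisms, on distributive lattices. -/
noncomputable def precompPullbackDLIso {X : Type w} [Category.{u} X] [HasFiniteProducts X]
    {Y : Type w'} [Category.{u} Y] [HasFiniteProducts Y] {Z : Type v} [Category.{u} Z]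
    [HasFiniteProducts Z] (g : GeomMor Y X) (D : InternalDL Z) :
    g.precomp ⋙ pullbackDL D ≅ pullbackDL D ⋙ mapInternalDL g.inverse :=
  NatIso.ofComponents (fun f =>
    have := (g.comp f).lex
    have : PreservesFiniteLimits (f.inverse ⋙ g.inverse) := this
    InternalDL.mapCompIso f.inverse g.inverse D) fun _ =>
      InternalDL.Hom.ext ((Category.comp_id _).trans (Category.id_comp _).symm)

/-- A flat lattice in a category of sheaves is a pullback of the interval, along the geometric
morphism whose inverse image is the tensor product with the lattice. -/
theorem exists_pullbackDL_iso_sheaf {C : Type u} [SmallCategory C] {J : GrothendieckTopology C}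
    {D : InternalDL (Sheaf J (Type u))} (hD : D.IsFlat) :
    ∃ f : GeomMor (Sheaf J (Type u)) CubicalSet.{u},
      Nonempty ((pullbackDL CubicalSet.intervalDL.{u}).obj f ≅ D) := by
  have := hD.preservesFiniteLimits_tensor
  exact ⟨⟨D.tensor, _, D.tensorAdj, this⟩, D.nonempty_tensor_interval_iso⟩

/-- Every flat distributive lattice in a topos is the inverse image of the interval: it suffices to
see this in an equivalent topos of sheaves. -/
theorem exists_pullbackDL_iso {X : Type w} [Category.{u} X] [h : IsGrothendieckTopos X]
    {D : InternalDL X} (hD : D.IsFlat) :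
    ∃ f : GeomMor X CubicalSet.{u},
      Nonempty ((pullbackDL CubicalSet.intervalDL.{u}).obj f ≅ D) := by
  obtain ⟨C, _, J, ⟨e⟩⟩ := h.exists_site
  obtain ⟨f, ⟨i⟩⟩ := exists_pullbackDL_iso_sheaf (hD.map e.toAdjunction)
  let g : GeomMor X (Sheaf J (Type u)) :=
    ⟨e.inverse, e.functor, e.symm.toAdjunction, inferInstance⟩
  obtain ⟨j⟩ := D.nonempty_map_iso_of_iso e.unitIso
  obtain ⟨k⟩ := D.nonempty_map_id_iso
  exact ⟨g.comp f, ⟨(g.precompPullbackDLIso CubicalSet.intervalDL.{u}).app f ≪≫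
    (mapInternalDL e.inverse).mapIso i ≪≫
    (InternalDL.mapCompIso e.functor e.inverse D).symm ≪≫ j.symm ≪≫ k⟩⟩

end GeomMor

/-- The topos of cubical sets classifies flat distributive lattices, with generic model `𝕀`. -/
theorem mainTheorem1 :
    IsGrothendieckTopos CubicalSet.{u} ∧
    InternalDL.IsFlat CubicalSet.intervalDL.{u} ∧
    (∀ (X : Type w) [Category.{u} X] [IsGrothendieckTopos X],
      ∃ h : ∀ f : GeomMor X CubicalSet.{u},
          InternalDL.IsFlat ((GeomMor.pullbackDL CubicalSet.intervalDL.{u}).obj f),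
        (ObjectProperty.lift InternalDL.IsFlat
          (GeomMor.pullbackDL (X := X) CubicalSet.intervalDL.{u}) h).IsEquivalence) ∧
    (∀ (X : Type w) [Category.{u} X] [IsGrothendieckTopos X]
      (Y : Type w') [Category.{u} Y] [IsGrothendieckTopos Y] (g : GeomMor Y X),
      (∀ D : InternalDL X, D.IsFlat → ((mapInternalDL g.inverse).obj D).IsFlat) ∧
      Nonempty (g.precomp ⋙ GeomMor.pullbackDL CubicalSet.intervalDL.{u} ≅
        GeomMor.pullbackDL CubicalSet.intervalDL ⋙ mapInternalDL g.inverse)) := by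
  refine ⟨isGrothendieckTopos_cubicalSet, CubicalSet.isFlat_intervalDL, fun X _ _ => ?_,
    fun X _ _ Y _ _ g => ⟨fun D hD => hD.map g.adj, ⟨g.precompPullbackDLIso _⟩⟩⟩
  refine ⟨fun f => CubicalSet.isFlat_intervalDL.map f.adj, ?_⟩
  have := GeomMor.faithful_pullbackDL X
  have := GeomMor.full_pullbackDL X
  exact
    { faithful := Functor.Faithful.of_comp_iso (ObjectProperty.liftCompιIso _ _ _)
      full := Functor.Full.of_comp_faithful_iso (ObjectProperty.liftCompιIso _ _ _)
      essSurj := ⟨fun D => by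
        obtain ⟨f, ⟨i⟩⟩ := GeomMor.exists_pullbackDL_iso D.property
        exact ⟨f, ⟨InternalDL.IsFlat.isoMk i⟩⟩⟩ }
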